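/- Let $(\Omega,\mathcal F,P)$ be a probability space with a filtration $(\mathcal F_n)_{n\ge 0}$, and let $(S_n)_{n\ge 0}$ be a real martingale with respect to it with $S_0=0$ a.s. Put $x_n=S_n-S_{n-1}$ for $n\ge1$, and suppose that for every $n\ge 1$ there is an $\mathcal F_{n-1}$-measurable real random variable $c_n$ with $|x_n|\le c_n$ a.s. Let $A_n\ge 0$ be given by $A_n^2=\sum_{i=1}^n x_i^2$. Let $\psi$ be a positive, non-decreasing and continuous real function on $[1,\infty)$ (extended in any way to a real function on $\mathbb R$), and let $$I(\psi)=\int_1^\infty \psi(\lambda)\,e^{-\psi(\lambda)^2/2}\,\frac{d\lambda}{\lambda}\in[0,\infty].$$ Let $B$ be the event that $\lim_n A_n=\infty$ and $\limsup_n c_n\,\psi(A_n^2)^3/A_n<\infty$. 1. If $I(\psi)<\infty$, then for $P$-almost every $\omega\in B$ we have $S_n<A_n\psi(A_n^2)$ for all sufficiently large $n$. 2. If $I(\psi)=\infty$ and $\psi(\lambda)\to\infty$ as $\lambda\to\infty$, then for $P$-almost every $\omega\in B$ we have $S_n\ge A_n\psi(A_n^2)$ for infinitely many $n$. (When $P(B)>0$,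 the conclusions say that the respective events have conditional probability $1$ given $B$.) -/

import Mathlib

open MeasureTheory ProbabilityTheory Filter

namespace SelfNormalized

noncomputable section

/-- The integral `I(ψ) = ∫₁^∞ ψ(t) exp(-ψ(t)² / 2) dt / t`, with values in `[0, ∞]`. -/
def efkpIntegral (ψ : ℝ → ℝ) : ENNReal :=
  ∫⁻ t in Set.Ici (1 : ℝ), ENNReal.ofReal (ψ t * Real.exp (-(ψ t) ^ 2 / 2) / t)

/-- The increment `x_n = S_n - S_{n-1}`; used for `n ≥ 1` only. -/
def increment {Ω : Type*} (S : ℕ → Ω → ℝ) (n : ℕ) (ω : Ω) : ℝ :=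
  S n ω - S (n - 1) ω

/-- The squared normalizer `A_n² = x_1² + ⋯ + x_n²`. -/
def quadVar {Ω : Type*} (S : ℕ → Ω → ℝ) (n : ℕ) (ω : Ω) : ℝ :=
  ∑ i ∈ Finset.Icc 1 n, (increment S i ω) ^ 2

/-- The normalizer `A_n ≥ 0`. -/
def normalizer {Ω : Type*} (S : ℕ → Ω → ℝ) (n : ℕ) (ω : Ω) : ℝ :=
  Real.sqrt (quadVar S n ω)

/-- The event `{ lim A_n = ∞, limsup c_n ψ(A_n²)³ / A_n < ∞ }`; the upper limit is taken in the
extended reals. -/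
def growthEvent {Ω : Type*} (S c : ℕ → Ω → ℝ) (ψ : ℝ → ℝ) : Set Ω :=
  {ω | Tendsto (fun n => normalizer S n ω) atTop atTop ∧
    limsup (fun n => ((c n ω * (ψ (quadVar S n ω)) ^ 3 / normalizer S n ω : ℝ) : EReal)) atTop
      < ⊤}

end

end SelfNormalized

namespace SelfNormalized

/-! The proof is a betting argument. Betting the fraction `λ` of current wealth on each increment
gives the wealth `∏ (1 + λ x_i) = exp (λ S_n - λ² A_n² / 2 + cubic error)`, an almost surely
nonnegative martingale while `|λ x_i| ≤ 1 / 2`. Work in the logarithmic clock `h = log A_n²` with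
profile `θ t = ψ (exp t)`. The bettor of level `τ` uses `λ = D / exp (τ / 2)`, where `D` is `θ τ` or
slightly less. If `S_n = exp (h / 2) θ(h)`, its log-wealth is about `D² / 2 - D² (exp ((h - τ) / 2)
- 1)² / 2`, a bump of height `D² / 2` and width `1 / D` around `h = τ`. Hence the natural grid has
steps `1 / θ`, and on it `I(ψ)` is comparable with `∑ exp (-θ(t_k)² / 2)`. The growth condition,
with its exponent 3, makes `λ |x_i|` of order `D⁻²` (`bet_mul_le`), so that the cubic error is
bounded.

Convergence: a crossing with the clock in the `k`-th cell gives bettor `k` wealth at least a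
constant times `exp (y_k² / 2)` (`exp_le_wealth_safeBet`). Ville's inequality bounds its probability
by a constant times `exp (-y_k² / 2)`; these are summable, and Borel–Cantelli concludes. The levels
`y_k ≤ θ(t_k)` are capped so that they cannot jump (`exists_upper_grid`).

Divergence: give bettor `k` the stake `exp (-θ(t_k)² / 2)` and take finitely many remote levels with
total stake between 1 and 2. While the path stays below the boundary, the stake cancels the height
of the bump, and summing the bumps bounds the total wealth by a constant `B` independent of the
starting time (`exists_mixture_le`). Once the clock has passed all levels, the total is at most `1 /
2`. Since the mean is conserved and at least 1, the conditional probability of never crossing is at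
most `(B - 1) / (B - 1 / 2) < 1`. By Lévy's zero-one law never crossing is then a null event
(`measure_eq_zero_of_forall_inter_le`). -/

lemma abs_log_one_add_sub_le {y : ℝ} (hy : |y| ≤ 1 / 2) :
    |Real.log (1 + y) - (y - y ^ 2 / 2)| ≤ 2 * |y| * y ^ 2 := by
  have h := Real.abs_log_sub_add_sum_range_le (x := -y) (by rw [abs_neg]; linarith) 2
  simp only [Finset.sum_range_succ, Finset.sum_range_zero, abs_neg, sub_neg_eq_add] at h
  norm_num at h
  have h1 : |y| ^ 3 / (1 - |y|) ≤ 2 * |y| * y ^ 2 := by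
    rw [div_le_iff₀ (by linarith), ← sq_abs y]
    have : 0 ≤ |y| ^ 3 := by positivity
    nlinarith
  calc _ = |-y + y ^ 2 / 2 + Real.log (1 + y)| := by congr 1; ring
    _ ≤ _ := h.trans h1

/-- Taylor expansion of the logarithm to second order; the cubic remainder costs a factor `δ` on the
quadratic sum, and so stays bounded when `δ` is of the order of the inverse of that sum. -/
lemma prod_one_add_le_exp {ι : Type*} (s : Finset ι) (y : ι → ℝ) {δ : ℝ} (hδ : δ ≤ 1 / 2)
    (h : ∀ i ∈ s, |y i| ≤ δ) :
    ∏ i ∈ s, (1 + y i) ≤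
      Real.exp (∑ i ∈ s, y i - (∑ i ∈ s, y i ^ 2) / 2 + 2 * δ * ∑ i ∈ s, y i ^ 2) := by
  rw [Finset.sum_div, Finset.mul_sum, ← Finset.sum_sub_distrib, ← Finset.sum_add_distrib,
    Real.exp_sum]
  refine Finset.prod_le_prod (fun i hi => ?_) fun i hi => ?_
  · linarith [neg_abs_le (y i), h i hi]
  · have h1 := h i hi
    have h2 := (abs_le.1 (abs_log_one_add_sub_le (h1.trans hδ))).2
    have h3 : 0 < 1 + y i := by linarith [neg_abs_le (y i)]
    rw [← Real.exp_log h3]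
    refine Real.exp_le_exp.2 ?_
    nlinarith [mul_le_mul_of_nonneg_right h1 (sq_nonneg (y i))]

lemma exp_le_prod_one_add {ι : Type*} (s : Finset ι) (y : ι → ℝ) {δ : ℝ} (hδ : δ ≤ 1 / 2)
    (h : ∀ i ∈ s, |y i| ≤ δ) :
    Real.exp (∑ i ∈ s, y i - (∑ i ∈ s, y i ^ 2) / 2 - 2 * δ * ∑ i ∈ s, y i ^ 2) ≤
      ∏ i ∈ s, (1 + y i) := by
  rw [Finset.sum_div, Finset.mul_sum, ← Finset.sum_sub_distrib, ← Finset.sum_sub_distrib,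
    Real.exp_sum]
  refine Finset.prod_le_prod (fun i hi => (Real.exp_pos _).le) fun i hi => ?_
  have h1 := h i hi
  have h2 := (abs_le.1 (abs_log_one_add_sub_le (h1.trans hδ))).1
  have h3 : 0 < 1 + y i := by linarith [neg_abs_le (y i)]
  rw [← Real.exp_log h3]
  refine Real.exp_le_exp.2 ?_
  nlinarith [mul_le_mul_of_nonneg_right h1 (sq_nonneg (y i))]

/-! ### Wealth martingales and Ville's inequality -/

/-- The wealth of a gambler who starts with `1` and bets the fraction `b i` of the current wealth
on the increment `S (i + 1) - S i`. -/
def wealth {Ω : Type*} (S b : ℕ → Ω → ℝ) (n : ℕ) (ω : Ω) : ℝ :=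
  ∏ i ∈ Finset.range n, (1 + b i ω * (S (i + 1) ω - S i ω))

section Wealth

variable {Ω : Type*} {mΩ : MeasurableSpace Ω} {P : Measure Ω} {ℱ : Filtration ℕ mΩ}
  {S b : ℕ → Ω → ℝ}

lemma wealth_succ (n : ℕ) (ω : Ω) :
    wealth S b (n + 1) ω = wealth S b n ω * (1 + b n ω * (S (n + 1) ω - S n ω)) :=
  Finset.prod_range_succ _ _

lemma ae_wealth_nonneg (hb : ∀ i, ∀ᵐ ω ∂P, |b i ω * (S (i + 1) ω - S i ω)| ≤ 1 / 2) :
    ∀ᵐ ω ∂P, ∀ n, 0 ≤ wealth S b n ω := by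
  filter_upwards [ae_all_iff.2 hb] with ω hω n
  exact Finset.prod_nonneg fun i _ => by linarith [(abs_le.1 (hω i)).1]

lemma stronglyMeasurable_wealth (hS : Martingale S ℱ P)
    (hbm : ∀ i, Measurable[ℱ i] (b i)) (n : ℕ) : StronglyMeasurable[ℱ n] (wealth S b n) := by
  refine Finset.stronglyMeasurable_fun_prod _ fun i hi => ?_
  have hi : i < n := Finset.mem_range.1 hi
  exact stronglyMeasurable_const.add (((hbm i).stronglyMeasurable.mono (ℱ.mono hi.le)).mul
    (((hS.stronglyMeasurable (i + 1)).mono (ℱ.mono hi)).sub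
      ((hS.stronglyMeasurable i).mono (ℱ.mono hi.le))))

lemma integrable_wealth [IsProbabilityMeasure P] (hS : Martingale S ℱ P)
    (hbm : ∀ i, Measurable[ℱ i] (b i))
    (hb : ∀ i, ∀ᵐ ω ∂P, |b i ω * (S (i + 1) ω - S i ω)| ≤ 1 / 2) (n : ℕ) :
    Integrable (wealth S b n) P := by
  refine Integrable.of_bound
    ((stronglyMeasurable_wealth hS hbm n).mono (ℱ.le n)).aestronglyMeasurable (2 ^ n) ?_
  filter_upwards [ae_all_iff.2 hb] with ω hω
  rw [wealth, norm_prod]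
  refine (Finset.prod_le_prod (g := fun _ => (2 : ℝ)) (fun i _ => norm_nonneg _)
    fun i _ => ?_).trans (by simp)
  rw [Real.norm_eq_abs, abs_le]
  have := abs_le.1 (hω i)
  constructor <;> linarith [this.1, this.2]

lemma martingale_wealth [IsProbabilityMeasure P] (hS : Martingale S ℱ P)
    (hbm : ∀ i, Measurable[ℱ i] (b i))
    (hb : ∀ i, ∀ᵐ ω ∂P, |b i ω * (S (i + 1) ω - S i ω)| ≤ 1 / 2) :
    Martingale (wealth S b) ℱ P := by
  refine martingale_of_condExp_sub_eq_zero_nat (stronglyMeasurable_wealth hS hbm)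
    (integrable_wealth hS hbm hb) fun n => ?_
  have hΔ : Integrable (S (n + 1) - S n) P := (hS.integrable _).sub (hS.integrable _)
  have heq : wealth S b (n + 1) - wealth S b n =
      (wealth S b n * b n) * (S (n + 1) - S n) := by
    ext ω
    simp only [Pi.sub_apply, Pi.mul_apply, wealth_succ]
    ring
  have hint : Integrable ((wealth S b n * b n) * (S (n + 1) - S n)) P := by
    rw [← heq]
    exact (integrable_wealth hS hbm hb _).sub (integrable_wealth hS hbm hb _)
  rw [heq]
  have h1 := condExp_mul_of_stronglyMeasurable_left (μ := P) (m := ℱ n)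
    ((stronglyMeasurable_wealth hS hbm n).mul (hbm n).stronglyMeasurable) hint hΔ
  have h2 : P[S (n + 1) - S n | ℱ n] =ᵐ[P] 0 := by
    have h3 := condExp_sub (hS.integrable (n + 1)) (hS.integrable n) (ℱ n)
    filter_upwards [h3, hS.condExp_ae_eq (Nat.le_succ n), hS.condExp_ae_eq (le_refl n)]
      with ω e1 e2 e3
    rw [e1, Pi.sub_apply, e2, e3]
    simp
  filter_upwards [h1, h2] with ω e1 e2
  rw [e1, Pi.mul_apply, e2]
  simp

/-- Ville's inequality for the wealth process. -/
lemma measure_exists_le_wealth_le [IsProbabilityMeasure P] (hS : Martingale S ℱ P)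
    (hbm : ∀ i, Measurable[ℱ i] (b i))
    (hb : ∀ i, ∀ᵐ ω ∂P, |b i ω * (S (i + 1) ω - S i ω)| ≤ 1 / 2) {ε : ℝ} (hε : 0 < ε) :
    P {ω | ∃ n, ε ≤ wealth S b n ω} ≤ ENNReal.ofReal (1 / ε) := by
  have hmart := martingale_wealth hS hbm hb
  -- The wealth is nonnegative only almost surely, whereas `maximal_ineq` asks for it everywhere;
  -- hence the positive part.
  have hsub := hmart.submartingale.pos
  set g : ℕ → Ω → ℝ := (wealth S b)⁺ with hg
  have hg0 : 0 ≤ g := fun n ω => by simp [hg]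
  have hle : ∀ n ω, wealth S b n ω ≤ g n ω := fun n ω => by simp [hg]; exact le_max_left _ _
  have hgi : ∀ n, ∫ ω, g n ω ∂P = 1 := by
    intro n
    have h0 : ∫ ω, g n ω ∂P = ∫ ω, wealth S b n ω ∂P := by
      refine integral_congr_ae ?_
      filter_upwards [ae_wealth_nonneg hb] with ω hω
      simp [hg]
      exact hω n
    have h1 := hmart.setIntegral_eq (Nat.zero_le n) MeasurableSet.univ
    simp only [setIntegral_univ] at h1
    rw [h0, ← h1]
    simp [wealth]
  lift ε to NNReal using hε.le
  let E : ℕ → Set Ω := fun n =>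
    {ω | (ε : ℝ) ≤ (Finset.range (n + 1)).sup' Finset.nonempty_range_add_one fun k => g k ω}
  have hE : ∀ n, P (E n) ≤ ENNReal.ofReal (1 / ε) := by
    intro n
    have h1 : ε * P (E n) ≤ ENNReal.ofReal (∫ ω in E n, g n ω ∂P) := maximal_ineq hsub hg0 n
    have h2 : ∫ ω in E n, g n ω ∂P ≤ 1 := by
      rw [← hgi n]
      exact setIntegral_le_integral (hsub.integrable n) (Eventually.of_forall (hg0 n))
    have h3 : ε * P (E n) ≤ 1 :=
      h1.trans ((ENNReal.ofReal_le_ofReal h2).trans_eq ENNReal.ofReal_one)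
    rw [one_div, ENNReal.ofReal_inv_of_pos hε, ENNReal.ofReal_coe_nnreal]
    rw [mul_comm] at h3
    exact ENNReal.le_inv_iff_mul_le.2 h3
  have hmono : Monotone E := by
    intro m n hmn ω hω
    refine le_trans (Set.mem_ofPred.1 hω) ?_
    exact Finset.sup'_mono _ (Finset.range_mono (by omega)) _
  calc P {ω | ∃ n, ε ≤ wealth S b n ω} ≤ P (⋃ n, E n) := by
        refine measure_mono fun ω ⟨n, hn⟩ => Set.mem_iUnion.2 ⟨n, ?_⟩
        exact (hn.trans (hle n ω)).trans
          (Finset.le_sup' (fun k => g k ω) (Finset.mem_range.2 n.lt_succ_self))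
    _ = ⨆ n, P (E n) := hmono.measure_iUnion
    _ ≤ _ := iSup_le hE

end Wealth

/-! ### The logarithmic clock and the growth condition -/

section Clock

/-- The boundary `ψ` in the logarithmic scale, set to `0` on the negative half-line. -/
noncomputable def logProfile (ψ : ℝ → ℝ) (t : ℝ) : ℝ :=
  if t < 0 then 0 else ψ (Real.exp t)

/-- The logarithm of `A_n²`, truncated below at `t₀`. -/
noncomputable def logClock {Ω : Type*} (S : ℕ → Ω → ℝ) (t₀ : ℝ) (n : ℕ) (ω : Ω) : ℝ :=
  Real.log (max (quadVar S n ω) (Real.exp t₀))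

variable {ψ : ℝ → ℝ}

lemma logProfile_of_nonneg {t : ℝ} (ht : 0 ≤ t) : logProfile ψ t = ψ (Real.exp t) :=
  if_neg ht.not_gt

lemma monotone_logProfile (hpos : ∀ t ∈ Set.Ici (1 : ℝ), 0 < ψ t)
    (hmono : MonotoneOn ψ (Set.Ici (1 : ℝ))) : Monotone (logProfile ψ) := by
  intro s t hst
  unfold logProfile
  by_cases ht : t < 0
  · rw [if_pos ht, if_pos (hst.trans_lt ht)]
  · have ht' : (1 : ℝ) ≤ Real.exp t := Real.one_le_exp (not_lt.1 ht)
    rw [if_neg ht]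
    by_cases hs : s < 0
    · rw [if_pos hs]
      exact (hpos _ ht').le
    · rw [if_neg hs]
      exact hmono (Real.one_le_exp (not_lt.1 hs)) ht' (Real.exp_le_exp.2 hst)

variable {Ω : Type*} {S : ℕ → Ω → ℝ} {t₀ : ℝ}

lemma quadVar_succ (n : ℕ) (ω : Ω) :
    quadVar S (n + 1) ω = quadVar S n ω + (S (n + 1) ω - S n ω) ^ 2 := by
  rw [quadVar, Finset.sum_Icc_succ_top (by omega)]
  simp [quadVar, increment]

lemma quadVar_eq_sum_range (n : ℕ) (ω : Ω) :
    quadVar S n ω = ∑ i ∈ Finset.range n, (S (i + 1) ω - S i ω) ^ 2 := by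
  induction n with
  | zero => simp [quadVar]
  | succ n ih => rw [quadVar_succ, ih, Finset.sum_range_succ]

lemma quadVar_nonneg (n : ℕ) (ω : Ω) : 0 ≤ quadVar S n ω :=
  Finset.sum_nonneg fun _ _ => sq_nonneg _

lemma monotone_quadVar (ω : Ω) : Monotone fun n => quadVar S n ω :=
  monotone_nat_of_le_succ fun n => by
    rw [quadVar_succ]
    linarith [sq_nonneg (S (n + 1) ω - S n ω)]

lemma exp_logClock (n : ℕ) (ω : Ω) :
    Real.exp (logClock S t₀ n ω) = max (quadVar S n ω) (Real.exp t₀) :=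
  Real.exp_log (lt_max_of_lt_right (Real.exp_pos _))

lemma quadVar_le_exp_logClock (n : ℕ) (ω : Ω) :
    quadVar S n ω ≤ Real.exp (logClock S t₀ n ω) := by
  rw [exp_logClock]
  exact le_max_left _ _

lemma exp_logClock_le (n : ℕ) (ω : Ω) :
    Real.exp (logClock S t₀ n ω) ≤ quadVar S n ω + Real.exp t₀ := by
  rw [exp_logClock]
  exact max_le (by linarith [Real.exp_pos t₀]) (by linarith [quadVar_nonneg (S := S) n ω])

lemma exp_logClock_succ_le (n : ℕ) (ω : Ω) :
    Real.exp (logClock S t₀ (n + 1) ω) ≤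
      Real.exp (logClock S t₀ n ω) + (S (n + 1) ω - S n ω) ^ 2 := by
  rw [exp_logClock, exp_logClock, quadVar_succ]
  have := sq_nonneg (S (n + 1) ω - S n ω)
  refine max_le ?_ ?_
  · linarith [le_max_left (quadVar S n ω) (Real.exp t₀)]
  · linarith [le_max_right (quadVar S n ω) (Real.exp t₀)]

lemma exp_logClock_of_le {n : ℕ} {ω : Ω} (h : Real.exp t₀ ≤ quadVar S n ω) :
    Real.exp (logClock S t₀ n ω) = quadVar S n ω := by
  rw [exp_logClock, max_eq_left h]

lemma normalizer_eq_exp {n : ℕ} {ω : Ω} (h : Real.exp t₀ ≤ quadVar S n ω) :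
    normalizer S n ω = Real.exp (logClock S t₀ n ω / 2) := by
  rw [normalizer, ← exp_logClock_of_le h, Real.exp_half]

lemma le_logClock (n : ℕ) (ω : Ω) : t₀ ≤ logClock S t₀ n ω := by
  rw [← Real.exp_le_exp, exp_logClock]
  exact le_max_right _ _

lemma monotone_logClock (ω : Ω) : Monotone fun n => logClock S t₀ n ω := by
  intro m n hmn
  show logClock S t₀ m ω ≤ logClock S t₀ n ω
  rw [← Real.exp_le_exp, exp_logClock, exp_logClock]
  exact max_le_max_right _ (monotone_quadVar ω hmn)

lemma logProfile_logClock (ht₀ : 0 ≤ t₀) {n : ℕ} {ω : Ω} (h : Real.exp t₀ ≤ quadVar S n ω) :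
    logProfile ψ (logClock S t₀ n ω) = ψ (quadVar S n ω) := by
  rw [logProfile_of_nonneg (ht₀.trans (le_logClock n ω)), exp_logClock_of_le h]

lemma measurable_quadVar {mΩ : MeasurableSpace Ω} {ℱ : Filtration ℕ mΩ}
    (hS : StronglyAdapted ℱ S) (n : ℕ) : Measurable[ℱ n] (quadVar S n) := by
  have : quadVar S n = fun ω => ∑ i ∈ Finset.range n, (S (i + 1) ω - S i ω) ^ 2 :=
    funext fun ω => quadVar_eq_sum_range n ω
  rw [this]
  refine Finset.measurable_sum _ fun i hi => ?_
  have hi := Finset.mem_range.1 hi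
  exact ((((hS (i + 1)).mono (ℱ.mono hi)).measurable).sub
    (((hS i).mono (ℱ.mono hi.le)).measurable)).pow_const 2

lemma measurable_logClock {mΩ : MeasurableSpace Ω} {ℱ : Filtration ℕ mΩ}
    (hS : StronglyAdapted ℱ S) (n : ℕ) : Measurable[ℱ n] (logClock S t₀ n) :=
  Real.measurable_log.comp ((measurable_quadVar hS n).max measurable_const)

lemma tendsto_quadVar_of_mem {c : ℕ → Ω → ℝ} {ω : Ω} (h : ω ∈ growthEvent S c ψ) :
    Tendsto (fun n => quadVar S n ω) atTop atTop := by
  have h1 : Tendsto (fun n => normalizer S n ω ^ 2) atTop atTop :=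
    (tendsto_pow_atTop two_ne_zero).comp h.1
  exact h1.congr fun n => Real.sq_sqrt (quadVar_nonneg n ω)

lemma tendsto_logClock {ω : Ω} (h : Tendsto (fun n => quadVar S n ω) atTop atTop) :
    Tendsto (fun n => logClock S t₀ n ω) atTop atTop :=
  Real.tendsto_log_atTop.comp (tendsto_atTop_mono (fun _ => le_max_left _ _) h)

/-- On the growth event the next increment is controlled by the present value of the clock. -/
lemma exists_step_bound (hpos : ∀ t ∈ Set.Ici (1 : ℝ), 0 < ψ t)
    (hmono : MonotoneOn ψ (Set.Ici (1 : ℝ))) (htop : Tendsto ψ atTop atTop) (ht₀ : 0 ≤ t₀)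
    {c : ℕ → Ω → ℝ} {ω : Ω} (hx : ∀ i, |S (i + 1) ω - S i ω| ≤ c (i + 1) ω)
    (hω : ω ∈ growthEvent S c ψ) :
    ∃ C : ℕ, 1 ≤ C ∧ ∀ i, c (i + 1) ω * logProfile ψ (logClock S t₀ i ω) ^ 3 ≤
      C * Real.exp (logClock S t₀ i ω / 2) := by
  have hQ := tendsto_quadVar_of_mem hω
  obtain ⟨M, hM, -⟩ := EReal.lt_iff_exists_real_btwn.1 hω.2
  have hlim := eventually_lt_of_limsup_lt hM
  -- The growth condition involves `A_{n+1}`, which is not known when the bet is placed. Since `ψ³ ≥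
  -- 2K` eventually, it forces `c_{n+1} ≤ A_{n+1} / 2`, whence `A_{n+1} ≤ 2 A_n`, and `A_n` may
  -- replace `A_{n+1}` at the cost of a factor 2.
  set K := max M 1 with hK
  have hK1 : 1 ≤ K := le_max_right _ _
  have hQ1 : Tendsto (fun n => quadVar S (n + 1) ω) atTop atTop :=
    hQ.comp (tendsto_add_atTop_nat 1)
  have hev : ∀ᶠ n in atTop, c (n + 1) ω * logProfile ψ (logClock S t₀ n ω) ^ 3 *
      Real.exp (-(logClock S t₀ n ω / 2)) ≤ 2 * K := by
    filter_upwards [(tendsto_add_atTop_nat 1).eventually hlim, hQ.eventually_ge_atTop (Real.exp t₀),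
      hQ1.eventually (htop.eventually_ge_atTop (2 * K))] with n h1 h2 h3
    have hQmono : quadVar S n ω ≤ quadVar S (n + 1) ω := monotone_quadVar ω (Nat.le_succ n)
    have hone : (1 : ℝ) ≤ quadVar S n ω := (Real.one_le_exp ht₀).trans h2
    set q := quadVar S (n + 1) ω with hq
    have hA : 0 < normalizer S (n + 1) ω := Real.sqrt_pos.2 (by linarith)
    have hA2 : normalizer S (n + 1) ω ^ 2 = q := Real.sq_sqrt (by linarith)
    have hc0 : 0 ≤ c (n + 1) ω := (abs_nonneg _).trans (hx n)
    have h4 : c (n + 1) ω * ψ q ^ 3 ≤ K * normalizer S (n + 1) ω := by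
      rw [← div_le_iff₀ hA]
      exact (EReal.coe_lt_coe_iff.1 h1).le.trans (le_max_left _ _)
    have h5 : c (n + 1) ω ≤ normalizer S (n + 1) ω / 2 := by
      have h6 : 2 * K ≤ ψ q ^ 3 := h3.trans (le_self_pow₀ (by linarith) (by norm_num))
      have h7 : c (n + 1) ω * (2 * K) ≤ K * normalizer S (n + 1) ω :=
        (mul_le_mul_of_nonneg_left h6 hc0).trans h4
      nlinarith
    have h6 : q ≤ 4 * quadVar S n ω := by
      have h7 := quadVar_succ (S := S) n ω
      have h8 : (S (n + 1) ω - S n ω) ^ 2 ≤ (normalizer S (n + 1) ω / 2) ^ 2 := by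
        rw [← sq_abs]
        exact pow_le_pow_left₀ (abs_nonneg _) ((hx n).trans h5) 2
      nlinarith
    have h7 : normalizer S (n + 1) ω ≤ 2 * normalizer S n ω := by
      refine abs_le_of_sq_le_sq' ?_ (by unfold normalizer; positivity) |>.2
      rw [hA2, mul_pow, normalizer, Real.sq_sqrt (by linarith)]
      linarith
    have h8 : ψ (quadVar S n ω) ≤ ψ q := hmono hone (hone.trans hQmono) hQmono
    rw [logProfile_logClock ht₀ h2, Real.exp_neg, ← normalizer_eq_exp h2, ← div_eq_mul_inv,
      div_le_iff₀ (show 0 < normalizer S n ω from Real.sqrt_pos.2 (by linarith))]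
    calc c (n + 1) ω * ψ (quadVar S n ω) ^ 3 ≤ c (n + 1) ω * ψ q ^ 3 :=
          mul_le_mul_of_nonneg_left (pow_le_pow_left₀ (hpos _ hone).le h8 3) hc0
      _ ≤ K * normalizer S (n + 1) ω := h4
      _ ≤ 2 * K * normalizer S n ω := by nlinarith
  have hb : BddAbove (Set.range fun n => c (n + 1) ω * logProfile ψ (logClock S t₀ n ω) ^ 3 *
      Real.exp (-(logClock S t₀ n ω / 2))) :=
    IsBoundedUnder.bddAbove_range (isBoundedUnder_of_eventually_le hev)
  obtain ⟨B, hB⟩ := hb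
  -- A natural constant, so that countably many values of `C` exhaust the growth event.
  obtain ⟨C, hC⟩ := exists_nat_ge (max B 1)
  refine ⟨C, by exact_mod_cast (le_max_right _ _).trans hC, fun i => ?_⟩
  have h1 := (hB ⟨i, rfl⟩).trans ((le_max_left B 1).trans hC)
  simp only [Real.exp_neg, ← div_eq_mul_inv] at h1
  rwa [div_le_iff₀ (Real.exp_pos _)] at h1

end Clock

/-! ### Smallness of the bets -/

/-- Admissible increments are small compared with the inverse bet size of the level `τ`. -/
lemma bet_mul_le {θ : ℝ → ℝ} (hθ : Monotone θ) {D C τ h c : ℝ} (hC : 1 ≤ C) (hCD : C ≤ D)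
    (hreg : D ≤ 3 * θ (τ - 8 * Real.log D)) (hh : h ≤ τ + Real.log 64) (hc0 : 0 ≤ c)
    (hθ1 : 1 ≤ θ h) (hc : c * θ h ^ 3 ≤ C * Real.exp (h / 2)) :
    D / Real.exp (τ / 2) * c ≤ 216 * C / D ^ 2 := by
  have hD : 0 < D := by linarith
  rw [div_mul_eq_mul_div, div_le_div_iff₀ (Real.exp_pos _) (by positivity)]
  -- Either the clock is so early that `exp (h / 2)` is smaller than `exp (τ / 2)` by the factor
  -- `D⁴`, or `θ h ≥ D / 3` and the cubic bound applies; then `216 = 27 * 8`, with `27 = 3³` and `8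
  -- = exp (log 64 / 2)` from the overshoot of the clock.
  rcases le_total h (τ - 8 * Real.log D) with hcase | hcase
  · have h1 : c ≤ C * Real.exp (h / 2) := by
      refine le_trans ?_ hc
      exact le_mul_of_one_le_right hc0 (one_le_pow₀ hθ1)
    have h2 : Real.exp (h / 2) * D ^ 4 ≤ Real.exp (τ / 2) := by
      have : D ^ 4 = Real.exp (4 * Real.log D) := by
        rw [mul_comm, Real.exp_mul, Real.exp_log hD]
        norm_cast
      rw [this, ← Real.exp_add]
      exact Real.exp_le_exp.2 (by linarith)
    have hD1 : D ^ 3 ≤ D ^ 4 := pow_le_pow_right₀ (by linarith) (by norm_num)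
    have he := Real.exp_pos (h / 2)
    calc D * c * D ^ 2 = c * D ^ 3 := by ring
      _ ≤ C * Real.exp (h / 2) * D ^ 4 := by gcongr
      _ = C * (Real.exp (h / 2) * D ^ 4) := by ring
      _ ≤ C * Real.exp (τ / 2) := by gcongr
      _ ≤ 216 * C * Real.exp (τ / 2) := by
        have : 0 ≤ C * Real.exp (τ / 2) := by positivity
        linarith
  · have h1 : D ≤ 3 * θ h := hreg.trans (by linarith [hθ hcase])
    have h2 : Real.exp (h / 2) ≤ 8 * Real.exp (τ / 2) := by
      have h64 : Real.exp (Real.log 64 / 2) = 8 := by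
        rw [show (64 : ℝ) = 8 ^ (2 : ℕ) by norm_num, Real.log_pow]
        push_cast
        rw [mul_div_cancel_left₀ _ two_ne_zero, Real.exp_log (by norm_num)]
      rw [← h64, ← Real.exp_add]
      exact Real.exp_le_exp.2 (by linarith)
    calc D * c * D ^ 2 = c * D ^ 3 := by ring
      _ ≤ c * (3 * θ h) ^ 3 := by gcongr
      _ = 27 * (c * θ h ^ 3) := by ring
      _ ≤ 27 * (C * Real.exp (h / 2)) := by gcongr
      _ ≤ 27 * (C * (8 * Real.exp (τ / 2))) := by gcongr
      _ = _ := by ring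

/-! ### A grid adapted to a convergent integral -/

section Grid

lemma mul_exp_neg_sq_antitone {v w : ℝ} (hv : 1 ≤ v) (hvw : v ≤ w) :
    w * Real.exp (-w ^ 2 / 2) ≤ v * Real.exp (-v ^ 2 / 2) := by
  have h1 : w ≤ v * Real.exp ((w ^ 2 - v ^ 2) / 2) := by
    have h2 := Real.add_one_le_exp ((w ^ 2 - v ^ 2) / 2)
    have h3 : w ≤ v * ((w ^ 2 - v ^ 2) / 2 + 1) := by
      nlinarith [mul_nonneg (sub_nonneg.2 hvw) (by nlinarith : 0 ≤ v * (w + v) / 2 - 1)]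
    exact h3.trans (mul_le_mul_of_nonneg_left h2 (by linarith))
  calc w * Real.exp (-w ^ 2 / 2)
      ≤ v * Real.exp ((w ^ 2 - v ^ 2) / 2) * Real.exp (-w ^ 2 / 2) :=
        mul_le_mul_of_nonneg_right h1 (Real.exp_pos _).le
    _ = v * Real.exp (-v ^ 2 / 2) := by
        rw [mul_assoc, ← Real.exp_add]
        ring_nf

lemma exists_grid_index {t : ℕ → ℝ} (ht : Tendsto t atTop atTop) {s : ℝ} (hs : t 0 ≤ s) :
    ∃ j, t j ≤ s ∧ s < t (j + 1) := by
  classical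
  have hex : ∃ n, s < t n := (ht.eventually_gt_atTop s).exists
  have hpos : Nat.find hex ≠ 0 := fun h0 => by
    have := Nat.find_spec hex
    rw [h0] at this
    linarith
  obtain ⟨j, hj⟩ := Nat.exists_eq_succ_of_ne_zero hpos
  refine ⟨j, not_lt.1 (Nat.find_min hex (by omega)), ?_⟩
  have := Nat.find_spec hex
  rwa [hj] at this

lemma summable_of_le_add_mul {s b : ℕ → ℝ} {ρ : ℝ} (hs : ∀ k, 0 ≤ s k) (hb0 : ∀ k, 0 ≤ b k)
    (hb : Summable b) (hρ : ρ < 1) (h : ∀ k, s (k + 1) ≤ b k + ρ * s k) :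
    Summable s := by
  refine summable_of_sum_range_le (c := (s 0 + ∑' k, b k) / (1 - ρ)) hs fun n => ?_
  rw [le_div_iff₀ (by linarith)]
  have h1 : ∑ i ∈ Finset.range (n + 1), s i ≤
      s 0 + ∑' k, b k + ρ * ∑ i ∈ Finset.range n, s i := by
    rw [Finset.sum_range_succ', Finset.mul_sum]
    have h2 : ∑ i ∈ Finset.range n, s (i + 1) ≤
        ∑ i ∈ Finset.range n, b i + ∑ i ∈ Finset.range n, ρ * s i := by
      rw [← Finset.sum_add_distrib]
      exact Finset.sum_le_sum fun i _ => h i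
    linarith [hb.sum_le_tsum (Finset.range n) fun i _ => hb0 i]
  rw [Finset.sum_range_succ] at h1
  linarith [hs n]

variable {ψ : ℝ → ℝ}

lemma logProfile_le_of_exp_le (hmono : MonotoneOn ψ (Set.Ici (1 : ℝ))) {t u : ℝ} (ht : 0 ≤ t) (hu : Real.exp t ≤ u) :
    logProfile ψ t ≤ ψ u := by
  rw [logProfile_of_nonneg ht]
  have : (1 : ℝ) ≤ Real.exp t := Real.one_le_exp ht
  exact hmono this (this.trans hu) hu

/-- Since `v exp (-v² / 2)` decreases for `v ≥ 1`, the integrand is at least its value with the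
profile and denominator taken at the right end. The cell has length at least `exp (t + 1 / y) / (2
y)`, and the prefactor `ψ` compensates `1 / y`. -/
lemma ofReal_exp_le_setLIntegral (hpos : ∀ t ∈ Set.Ici (1 : ℝ), 0 < ψ t)
    (hmono : MonotoneOn ψ (Set.Ici (1 : ℝ))) {t y : ℝ} (ht : 0 ≤ t) (hy : 1 ≤ y)
    (hyt : y ≤ logProfile ψ t) :
    ENNReal.ofReal (Real.exp (-(logProfile ψ (t + 1 / y)) ^ 2 / 2) / 2) ≤
      ∫⁻ u in Set.Ico (Real.exp t) (Real.exp (t + 1 / y)),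
        ENNReal.ofReal (ψ u * Real.exp (-(ψ u) ^ 2 / 2) / u) := by
  have hinv : 0 < 1 / y := by positivity
  have hinv1 : 1 / y ≤ 1 := (div_le_one (by linarith)).2 hy
  set t' := t + 1 / y with ht'
  set θ' := logProfile ψ t' with hθ'
  have hmon := monotone_logProfile hpos hmono
  have hyθ' : y ≤ θ' := hyt.trans (hmon (by linarith))
  have hθ'0 : 0 < θ' := by linarith
  have h1 : ENNReal.ofReal (θ' * Real.exp (-θ' ^ 2 / 2) / Real.exp t') *
      volume (Set.Ico (Real.exp t) (Real.exp t')) ≤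
      ∫⁻ u in Set.Ico (Real.exp t) (Real.exp t'),
        ENNReal.ofReal (ψ u * Real.exp (-(ψ u) ^ 2 / 2) / u) := by
    rw [← setLIntegral_const]
    refine setLIntegral_mono' measurableSet_Ico fun u hu => ENNReal.ofReal_le_ofReal ?_
    have hu1 : (1 : ℝ) ≤ u := (Real.one_le_exp ht).trans hu.1
    have h2 : 1 ≤ ψ u := (hy.trans hyt).trans (logProfile_le_of_exp_le hmono ht hu.1)
    have h3 : ψ u ≤ θ' := by
      rw [hθ', logProfile_of_nonneg (by linarith)]
      exact hmono hu1 (hu1.trans hu.2.le) hu.2.le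
    have h4 := mul_exp_neg_sq_antitone h2 h3
    have h5 : 0 ≤ ψ u * Real.exp (-ψ u ^ 2 / 2) := by positivity
    exact div_le_div₀ h5 h4 (by linarith) hu.2.le
  refine le_trans ?_ h1
  rw [Real.volume_Ico, ← ENNReal.ofReal_mul (by positivity)]
  refine ENNReal.ofReal_le_ofReal ?_
  have h6 : Real.exp t' - Real.exp t = Real.exp t' * (1 - Real.exp (-(1 / y))) := by
    rw [mul_sub, ← Real.exp_add]
    simp [ht']
  have h7 : 1 / y / 2 ≤ 1 - Real.exp (-(1 / y)) := by
    have h8 : (1 + 1 / y) * Real.exp (-(1 / y)) ≤ 1 := by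
      calc (1 + 1 / y) * Real.exp (-(1 / y)) ≤ Real.exp (1 / y) * Real.exp (-(1 / y)) := by
            gcongr
            linarith [Real.add_one_le_exp (1 / y)]
        _ = 1 := by rw [← Real.exp_add]; simp
    nlinarith [Real.exp_pos (-(1 / y))]
  rw [h6, div_mul_eq_mul_div, mul_left_comm, mul_div_cancel_left₀ _ (Real.exp_pos _).ne']
  have h9 : 1 ≤ θ' * (1 / y) := by
    rw [mul_one_div, one_le_div (by linarith)]
    exact hyθ'
  calc Real.exp (-θ' ^ 2 / 2) / 2 = Real.exp (-θ' ^ 2 / 2) * (1 / 2) := by ring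
    _ ≤ Real.exp (-θ' ^ 2 / 2) * (θ' * (1 / y) / 2) := by gcongr
    _ = θ' * Real.exp (-θ' ^ 2 / 2) * (1 / y / 2) := by ring
    _ ≤ _ := by gcongr

/-- If `ψ` is in the upper class, then the logarithmic scale has a grid whose levels `y` stay below
`ψ`, vary slowly, and have summable Gaussian weights. -/
lemma exists_upper_grid (hpos : ∀ t ∈ Set.Ici (1 : ℝ), 0 < ψ t)
    (hmono : MonotoneOn ψ (Set.Ici (1 : ℝ))) (hI : efkpIntegral ψ < ⊤) {t₀ : ℝ} (ht₀ : 0 ≤ t₀)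
    (h1 : 1 ≤ logProfile ψ t₀) :
    ∃ t y : ℕ → ℝ, t 0 = t₀ ∧ (∀ k, 1 ≤ y k) ∧ (∀ k, y k ≤ logProfile ψ (t k)) ∧
      (∀ k, t (k + 1) = t k + 1 / y k) ∧ Monotone y ∧ (∀ k, y (k + 1) ≤ y k + 1 / y k) ∧
      Summable fun k => Real.exp (-y k ^ 2 / 2) := by
  set θ := logProfile ψ with hθ
  have hmon : Monotone θ := monotone_logProfile hpos hmono
  -- The cap `y + 1 / y` makes the levels grow no faster than the grid times, even if `θ` jumps up
  -- steeply. It is also steep enough to raise `y²` by at least 2.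
  let step : ℝ × ℝ → ℝ × ℝ := fun p => (p.1 + 1 / p.2, min (θ (p.1 + 1 / p.2)) (p.2 + 1 / p.2))
  let p : ℕ → ℝ × ℝ := fun k => step^[k] (t₀, θ t₀)
  have hp : ∀ k, p (k + 1) = step (p k) := fun k => Function.iterate_succ_apply' _ _ _
  have hinv : ∀ k, t₀ ≤ (p k).1 ∧ 1 ≤ (p k).2 ∧ (p k).2 ≤ θ (p k).1 := by
    intro k
    induction k with
    | zero => exact ⟨le_refl _, h1, le_refl _⟩
    | succ k ih =>
      obtain ⟨i1, i2, i3⟩ := ih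
      have : 0 < 1 / (p k).2 := by positivity
      rw [hp]
      refine ⟨by simp only [step]; linarith, le_min ?_ (by linarith), min_le_left _ _⟩
      exact (i2.trans i3).trans (hmon (by linarith))
  have ht : ∀ k, (p (k + 1)).1 = (p k).1 + 1 / (p k).2 := fun k => by rw [hp]
  have hy : ∀ k, (p (k + 1)).2 = min (θ (p (k + 1)).1) ((p k).2 + 1 / (p k).2) := fun k => by
    rw [hp]
  have hmt : Monotone fun k => (p k).1 := monotone_nat_of_le_succ fun k => by
    have := (hinv k).2.1
    rw [ht]
    have : 0 < 1 / (p k).2 := by positivity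
    linarith
  have hsum : Summable fun k => Real.exp (-θ (p (k + 1)).1 ^ 2 / 2) := by
    have hle : ∑' k, ENNReal.ofReal (Real.exp (-θ (p (k + 1)).1 ^ 2 / 2) / 2) ≤
        efkpIntegral ψ := by
      calc _ ≤ ∑' k, ∫⁻ u in Set.Ico (Real.exp (p k).1) (Real.exp (p (k + 1)).1),
            ENNReal.ofReal (ψ u * Real.exp (-(ψ u) ^ 2 / 2) / u) := by
            refine ENNReal.tsum_le_tsum fun k => ?_
            rw [ht]
            exact ofReal_exp_le_setLIntegral hpos hmono (ht₀.trans (hinv k).1) (hinv k).2.1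
              (hinv k).2.2
        _ = ∫⁻ u in ⋃ k, Set.Ico (Real.exp (p k).1) (Real.exp (p (k + 1)).1),
            ENNReal.ofReal (ψ u * Real.exp (-(ψ u) ^ 2 / 2) / u) := by
            rw [lintegral_iUnion (fun _ => measurableSet_Ico)]
            exact Monotone.pairwise_disjoint_on_Ico_succ (f := fun k => Real.exp (p k).1)
              (Real.exp_monotone.comp hmt)
        _ ≤ efkpIntegral ψ := by
            refine lintegral_mono_set (Set.iUnion_subset fun k u hu => ?_)
            exact (Real.one_le_exp (ht₀.trans (hinv k).1)).trans hu.1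
    have h2 := ENNReal.summable_toReal (hle.trans_lt hI).ne
    have h3 := h2.mul_left 2
    refine h3.congr fun k => ?_
    rw [ENNReal.toReal_ofReal (by positivity)]
    ring
  refine ⟨fun k => (p k).1, fun k => (p k).2, rfl, fun k => (hinv k).2.1, fun k => (hinv k).2.2,
    ht, monotone_nat_of_le_succ fun k => ?_, fun k => ?_, ?_⟩
  · obtain ⟨i1, i2, i3⟩ := hinv k
    have : 0 < 1 / (p k).2 := by positivity
    rw [hy]
    exact le_min (i3.trans (hmon (hmt (Nat.le_succ k)))) (by linarith)
  · beta_reduce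
    rw [hy]
    exact min_le_right _ _
  -- Either the new level is `θ` itself, and its weight is paid for by the integral, or the cap is
  -- active and the weight shrinks by the factor `exp (-1)`.
  · refine summable_of_le_add_mul (ρ := Real.exp (-1)) (fun k => (Real.exp_pos _).le)
      (fun k => (Real.exp_pos _).le) hsum (by simp) fun k => ?_
    beta_reduce
    rcases min_choice (θ (p (k + 1)).1) ((p k).2 + 1 / (p k).2) with hc | hc
    · rw [hy, hc]
      have : 0 < Real.exp (-1) * Real.exp (-(p k).2 ^ 2 / 2) := by positivity
      linarith
    · have hle : Real.exp (-(p (k + 1)).2 ^ 2 / 2) ≤ Real.exp (-1) * Real.exp (-(p k).2 ^ 2 / 2) := by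
        rw [hy, hc, ← Real.exp_add]
        refine Real.exp_le_exp.2 ?_
        have i2 := (hinv k).2.1
        have e1 : (p k).2 * (1 / (p k).2) = 1 := mul_one_div_cancel (by linarith)
        nlinarith [sq_nonneg (1 / (p k).2)]
      have := Real.exp_pos (-θ (p (k + 1)).1 ^ 2 / 2)
      linarith

/-- If `ψ` were bounded, the integrand would dominate a positive multiple of `1 / u`, which is not
integrable at infinity. -/
lemma tendsto_of_efkpIntegral_lt_top (hpos : ∀ t ∈ Set.Ici (1 : ℝ), 0 < ψ t)
    (hmono : MonotoneOn ψ (Set.Ici (1 : ℝ))) (hI : efkpIntegral ψ < ⊤) :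
    Tendsto ψ atTop atTop := by
  have hunb : ∀ M : ℝ, ∃ t, 1 ≤ t ∧ M ≤ ψ t := by
    by_contra! hcon
    obtain ⟨M, hM⟩ := hcon
    have hψ1 : 0 < ψ 1 := hpos 1 (Set.mem_Ici.2 le_rfl)
    set ε := ψ 1 * Real.exp (-M ^ 2 / 2) with hε
    have hεpos : 0 < ε := by positivity
    have hle : ∫⁻ u in Set.Ici (1 : ℝ), ENNReal.ofReal (ε * u⁻¹) ≤ efkpIntegral ψ := by
      refine setLIntegral_mono' measurableSet_Ici fun u hu => ENNReal.ofReal_le_ofReal ?_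
      have hu1 : (1 : ℝ) ≤ u := hu
      rw [div_eq_mul_inv]
      have h1 : ψ 1 ≤ ψ u := hmono (Set.mem_Ici.2 le_rfl) hu hu1
      have h2 := (hM u hu1).le
      have h3 : 0 < ψ u := hψ1.trans_le h1
      have h4 : Real.exp (-M ^ 2 / 2) ≤ Real.exp (-ψ u ^ 2 / 2) :=
        Real.exp_le_exp.2 (by nlinarith)
      have h5 : ε ≤ ψ u * Real.exp (-ψ u ^ 2 / 2) := mul_le_mul h1 h4 (Real.exp_pos _).le h3.le
      gcongr
    have hint : IntegrableOn (fun u : ℝ => ε * u⁻¹) (Set.Ici 1) := by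
      refine ⟨by fun_prop, ?_⟩
      rw [hasFiniteIntegral_iff_ofReal]
      · exact hle.trans_lt hI
      · refine (ae_restrict_iff' measurableSet_Ici).2 (Eventually.of_forall fun u hu => ?_)
        have hu1 : (1 : ℝ) ≤ u := hu
        show 0 ≤ ε * u⁻¹
        positivity
    have h3 : IntegrableOn (fun u : ℝ => u⁻¹) (Set.Ioi 1) := by
      have := (hint.mono_set Set.Ioi_subset_Ici_self).const_mul ε⁻¹
      refine this.congr (Eventually.of_forall fun u => ?_)
      show ε⁻¹ * (ε * u⁻¹) = u⁻¹
      field_simp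
    exact not_integrableOn_Ioi_inv h3
  refine tendsto_atTop.2 fun M => ?_
  obtain ⟨t, ht1, ht⟩ := hunb M
  filter_upwards [eventually_ge_atTop t] with s hs
  exact ht.trans (hmono ht1 (ht1.trans hs) hs)

end Grid

/-! ### The convergence half -/

section Upper

/-- The bet of constant size `lam`, placed only when the announced bound makes it safe. -/
noncomputable def safeBet {Ω : Type*} (c : ℕ → Ω → ℝ) (lam : ℝ) (i : ℕ) (ω : Ω) : ℝ :=
  {ω | lam * c (i + 1) ω ≤ 1 / 2}.indicator (fun _ => lam) ω

lemma measurable_safeBet {Ω : Type*} {mΩ : MeasurableSpace Ω} {ℱ : Filtration ℕ mΩ}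
    {c : ℕ → Ω → ℝ} (hc : ∀ i, Measurable[ℱ i] (c (i + 1))) (lam : ℝ) (i : ℕ) :
    Measurable[ℱ i] (safeBet c lam i) := by
  have hset : MeasurableSet[ℱ i] {ω | lam * c (i + 1) ω ≤ 1 / 2} :=
    measurableSet_le ((hc i).const_mul lam) measurable_const
  exact Measurable.indicator measurable_const hset

lemma abs_safeBet_mul_le {Ω : Type*} {c : ℕ → Ω → ℝ} {lam x : ℝ} (hlam : 0 ≤ lam) {i : ℕ}
    {ω : Ω} (hx : |x| ≤ c (i + 1) ω) : |safeBet c lam i ω * x| ≤ 1 / 2 := by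
  unfold safeBet
  by_cases h : ω ∈ {ω | lam * c (i + 1) ω ≤ 1 / 2}
  · rw [Set.indicator_of_mem h, abs_mul, abs_of_nonneg hlam]
    exact (mul_le_mul_of_nonneg_left hx hlam).trans h
  · rw [Set.indicator_of_notMem h]
    norm_num

/-- Along a grid with slowly varying unbounded levels, each level is comparable with `θ` well before
its own time. -/
lemma eventually_le_three_mul {θ : ℝ → ℝ} (hθ : Monotone θ) {t y : ℕ → ℝ}
    (hy1 : ∀ k, 1 ≤ y k) (hyθ : ∀ k, y k ≤ θ (t k)) (ht : ∀ k, t (k + 1) = t k + 1 / y k)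
    (hylip : ∀ k, y (k + 1) ≤ y k + 1 / y k) (hy : Tendsto y atTop atTop)
    (httop : Tendsto t atTop atTop) :
    ∀ᶠ k in atTop, y k ≤ 3 * θ (t k - 8 * Real.log (y k)) := by
  -- Going back by `8 log y_k` in time, plus one grid step of length at most 1, lowers the level by
  -- at most `8 log y_k + 1 ≤ y_k / 3 + 1`, which is at most `2 y_k / 3` once `y_k ≥ 3`.
  have hanti : Monotone fun k => t k - y k := monotone_nat_of_le_succ fun k => by
    rw [ht]
    linarith [hylip k]
  have htmono : Monotone t := monotone_nat_of_le_succ fun k => by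
    rw [ht]
    have := hy1 k
    have : 0 < 1 / y k := by positivity
    linarith
  have hlog : ∀ᶠ u : ℝ in atTop, Real.log u ≤ u / 24 := by
    filter_upwards [Real.isLittleO_log_id_atTop.bound (show (0 : ℝ) < 1 / 24 by norm_num),
      eventually_ge_atTop 1] with u hu hu1
    rw [Real.norm_of_nonneg (Real.log_nonneg hu1), id, Real.norm_of_nonneg (by linarith)] at hu
    linarith
  filter_upwards [hy.eventually hlog, hy.eventually_ge_atTop 3,
    hy.eventually_ge_atTop (3 * y 0)] with k h1 h2 h3
  have hk0 : t 0 - y 0 ≤ t k - y k := hanti (Nat.zero_le k)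
  obtain ⟨j, hj1, hj2⟩ := exists_grid_index httop (s := t k - 8 * Real.log (y k))
    (by linarith [hy1 0])
  have hjk : j ≤ k := by
    by_contra hcon
    have := htmono (show k + 1 ≤ j by omega)
    rw [ht] at this
    have h4 : 0 < 1 / y k := by
      have := hy1 k
      positivity
    linarith [Real.log_nonneg (hy1 k)]
  have h5 : t j - y j ≤ t k - y k := hanti hjk
  have h6 : t (j + 1) ≤ t j + 1 := by
    rw [ht]
    have : 1 / y j ≤ 1 := (div_le_one (by linarith [hy1 j])).2 (hy1 j)
    linarith
  have h7 := (hyθ j).trans (hθ hj1)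
  linarith

/-- The wealth of the bettor at level `y` when the martingale exceeds the boundary. -/
lemma exp_le_wealth_safeBet {Ω : Type*} {S c : ℕ → Ω → ℝ} {θ : ℝ → ℝ} (hθ : Monotone θ)
    {t₀ τ y C : ℝ} (hθ1 : ∀ t, t₀ ≤ t → 1 ≤ θ t) (hC : 1 ≤ C) (hCy : 432 * C ≤ y)
    (hyθ : y ≤ θ τ) (hreg : y ≤ 3 * θ (τ - 8 * Real.log y)) {ω : Ω} {n : ℕ}
    (hx : ∀ i, |S (i + 1) ω - S i ω| ≤ c (i + 1) ω) (hS0 : S 0 ω = 0)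
    (hstep : ∀ i, c (i + 1) ω * θ (logClock S t₀ i ω) ^ 3 ≤ C * Real.exp (logClock S t₀ i ω / 2))
    (hQ : Real.exp t₀ ≤ quadVar S n ω)
    (hτ : τ ≤ logClock S t₀ n ω) (hτ' : logClock S t₀ n ω ≤ τ + 1 / y)
    (hS : Real.exp (logClock S t₀ n ω / 2) * θ (logClock S t₀ n ω) ≤ S n ω) :
    Real.exp (y ^ 2 / 2 - 1 / 2 - 1296 * C) ≤
      wealth S (safeBet c (y / Real.exp (τ / 2))) n ω := by
  have hy0 : 0 < y := by linarith
  set lam := y / Real.exp (τ / 2) with hlam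
  have hlam0 : 0 < lam := by positivity
  have h1y : 1 / y ≤ 1 := (div_le_one hy0).2 (by linarith)
  have hlog64 : 1 ≤ Real.log 64 := by
    rw [Real.le_log_iff_exp_le (by norm_num)]
    linarith [Real.exp_one_lt_d9]
  set δ := 216 * C / y ^ 2 with hδ
  have hδ2 : δ ≤ 1 / 2 := by
    rw [hδ, div_le_iff₀ (by positivity)]
    nlinarith
  have hlc : ∀ i ∈ Finset.range n, lam * c (i + 1) ω ≤ δ := by
    intro i hi
    have hmono := monotone_logClock (S := S) (t₀ := t₀) ω (Finset.mem_range.1 hi).le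
    exact bet_mul_le hθ hC (by linarith) hreg (by simp only at hmono; linarith)
      ((abs_nonneg _).trans (hx i)) (hθ1 _ (le_logClock i ω)) (hstep i)
  have hw : wealth S (safeBet c lam) n ω =
      ∏ i ∈ Finset.range n, (1 + lam * (S (i + 1) ω - S i ω)) := by
    refine Finset.prod_congr rfl fun i hi => ?_
    rw [safeBet, Set.indicator_of_mem]
    exact (hlc i hi).trans hδ2
  rw [hw]
  refine le_trans ?_ (exp_le_prod_one_add _ _ hδ2 fun i hi => ?_)
  · refine Real.exp_le_exp.2 ?_
    simp only [mul_pow]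
    rw [← Finset.mul_sum, ← Finset.mul_sum, Finset.sum_range_sub (fun i => S i ω), hS0, sub_zero,
      ← quadVar_eq_sum_range, ← exp_logClock_of_le hQ]
    set h := logClock S t₀ n ω with hh
    -- With this `u` the exponent is at least `y² u - y² u² / 2 = y² / 2 - y² (u - 1)² / 2`. The
    -- cell has width `1 / y`, so `u - 1 ≤ 1 / y` and the loss is at most `1 / 2`; the cubic error
    -- is at most `432 C u² ≤ 1296 C`.
    set u := Real.exp ((h - τ) / 2) with hu
    have hu1 : 1 ≤ u := Real.one_le_exp (by linarith)
    have hu2 : u ≤ 1 + 1 / y := by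
      have h2 : u ≤ Real.exp (1 / y / 2) := Real.exp_le_exp.2 (by linarith)
      have h3 : Real.exp (1 / y / 2) * (1 - 1 / y / 2) ≤ 1 := by
        calc Real.exp (1 / y / 2) * (1 - 1 / y / 2)
            ≤ Real.exp (1 / y / 2) * Real.exp (-(1 / y / 2)) := by
              gcongr
              linarith [Real.add_one_le_exp (-(1 / y / 2))]
          _ = 1 := by rw [← Real.exp_add]; simp
      have h4 : 0 < 1 / y := by positivity
      nlinarith [Real.exp_pos (1 / y / 2)]
    have e1 : Real.exp (h / 2) = u * Real.exp (τ / 2) := by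
      rw [hu, ← Real.exp_add]
      ring_nf
    have e2 : lam * Real.exp (h / 2) = y * u := by
      rw [e1, hlam]
      field_simp
    have e3 : lam ^ 2 * Real.exp h = y ^ 2 * u ^ 2 := by
      have : Real.exp h = Real.exp (h / 2) ^ 2 := by
        rw [← Real.exp_nat_mul]
        ring_nf
      rw [this, ← mul_pow, e2, mul_pow]
    have e4 : y ^ 2 * u ≤ lam * S n ω := by
      calc y ^ 2 * u = y * u * y := by ring
        _ ≤ y * u * θ h := by
          have := hyθ.trans (hθ hτ)
          gcongr
        _ = lam * (Real.exp (h / 2) * θ h) := by rw [← e2]; ring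
        _ ≤ _ := by gcongr
    have e5 : u ^ 2 ≤ 3 := by
      have : u ^ 2 = Real.exp (h - τ) := by
        rw [hu, ← Real.exp_nat_mul]
        ring_nf
      rw [this]
      exact (Real.exp_le_exp.2 (by linarith : h - τ ≤ 1)).trans (by linarith [Real.exp_one_lt_d9])
    have e6 : 2 * δ * (y ^ 2 * u ^ 2) ≤ 1296 * C := by
      have : 2 * δ * (y ^ 2 * u ^ 2) = 432 * C * u ^ 2 := by
        rw [hδ]
        field_simp
        ring
      rw [this]
      nlinarith
    have e7 : y ^ 2 * (u - 1) ^ 2 ≤ 1 := by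
      have h2 : y * (u - 1) ≤ 1 := by
        calc y * (u - 1) ≤ y * (1 / y) := by
              gcongr
              linarith
          _ = 1 := mul_one_div_cancel hy0.ne'
      have h3 : 0 ≤ y * (u - 1) := mul_nonneg hy0.le (by linarith)
      nlinarith
    rw [e3]
    linarith
  · rw [abs_mul, abs_of_pos hlam0]
    exact (mul_le_mul_of_nonneg_left (hx i) hlam0.le).trans (hlc i hi)

lemma ae_eventually_lt_of_efkpIntegral_lt_top {Ω : Type*} {mΩ : MeasurableSpace Ω} {P : Measure Ω}
    [IsProbabilityMeasure P] {ℱ : Filtration ℕ mΩ} {S c : ℕ → Ω → ℝ} {ψ : ℝ → ℝ}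
    (hS : Martingale S ℱ P) (hS0 : ∀ᵐ ω ∂P, S 0 ω = 0)
    (hc : ∀ i, Measurable[ℱ i] (c (i + 1)))
    (hx : ∀ᵐ ω ∂P, ∀ i, |S (i + 1) ω - S i ω| ≤ c (i + 1) ω)
    (hpos : ∀ t ∈ Set.Ici (1 : ℝ), 0 < ψ t) (hmono : MonotoneOn ψ (Set.Ici (1 : ℝ)))
    (hI : efkpIntegral ψ < ⊤) :
    ∀ᵐ ω ∂P, ω ∈ growthEvent S c ψ →
      ∀ᶠ n in atTop, S n ω < normalizer S n ω * ψ (quadVar S n ω) := by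
  have htop := tendsto_of_efkpIntegral_lt_top hpos hmono hI
  have hθ := monotone_logProfile hpos hmono
  obtain ⟨t₀, ht₀, hθ₀⟩ : ∃ t₀ : ℝ, 0 ≤ t₀ ∧ 1 ≤ logProfile ψ t₀ := by
    obtain ⟨t, h1, h2⟩ := ((Real.tendsto_exp_atTop.eventually
      (htop.eventually_ge_atTop 1)).and (eventually_ge_atTop 0)).exists
    exact ⟨t, h2, by rwa [logProfile_of_nonneg h2]⟩
  obtain ⟨t, y, htz, hy1, hyθ, htsucc, hymono, hylip, hsum⟩ :=
    exists_upper_grid hpos hmono hI ht₀ hθ₀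
  have hytop : Tendsto y atTop atTop := by
    refine tendsto_atTop_atTop_of_monotone hymono fun B => ?_
    obtain ⟨k, hk⟩ := (hsum.tendsto_atTop_zero.eventually_lt_const
      (Real.exp_pos (-B ^ 2 / 2))).exists
    refine ⟨k, ?_⟩
    have h1 := Real.exp_lt_exp.1 hk
    exact (abs_le_of_sq_le_sq' (by linarith : B ^ 2 ≤ y k ^ 2) (by linarith [hy1 k])).2
  have htge : ∀ k, y k - y 0 + t 0 ≤ t k := by
    intro k
    induction k with
    | zero => simp
    | succ k ih =>
      rw [htsucc]
      linarith [hylip k]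
  have httop : Tendsto t atTop atTop :=
    tendsto_atTop_mono htge (tendsto_atTop_add_const_right _ _
      (tendsto_atTop_add_const_right _ (-y 0) hytop))
  have hreg := eventually_le_three_mul hθ hy1 hyθ htsucc hylip hytop httop
  have hlam : ∀ k, 0 ≤ y k / Real.exp (t k / 2) := fun k => by
    have := hy1 k
    positivity
  -- Borel–Cantelli for every `C` at once, because the constant of the growth condition depends on
  -- `ω`.
  have hBC : ∀ᵐ ω ∂P, ∀ C : ℕ, ∀ᶠ k in atTop, ∀ n,
      wealth S (safeBet c (y k / Real.exp (t k / 2))) n ω <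
        Real.exp (y k ^ 2 / 2 - 1 / 2 - 1296 * C) := by
    refine ae_all_iff.2 fun C => ?_
    have hE : ∑' k, P {ω | ∃ n, Real.exp (y k ^ 2 / 2 - 1 / 2 - 1296 * C) ≤
        wealth S (safeBet c (y k / Real.exp (t k / 2))) n ω} ≠ ⊤ := by
      have hs : Summable fun k => 1 / Real.exp (y k ^ 2 / 2 - 1 / 2 - 1296 * C) := by
        refine (hsum.mul_left (Real.exp (1 / 2 + 1296 * C))).congr fun k => ?_
        rw [one_div (Real.exp _), ← Real.exp_neg, ← Real.exp_add]
        ring_nf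
      refine ne_top_of_le_ne_top hs.tsum_ofReal_ne_top (ENNReal.tsum_le_tsum fun k => ?_)
      refine measure_exists_le_wealth_le hS (measurable_safeBet hc _) (fun i => ?_)
        (Real.exp_pos _)
      filter_upwards [hx] with ω hω
      exact abs_safeBet_mul_le (hlam k) (hω i)
    filter_upwards [ae_eventually_notMem hE] with ω hω
    filter_upwards [hω] with k hk n
    by_contra hcon
    exact hk ⟨n, not_lt.1 hcon⟩
  filter_upwards [hS0, hx, hBC] with ω h0 hxω hω hmem
  obtain ⟨C, hC1, hC⟩ := exists_step_bound hpos hmono htop ht₀ hxω hmem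
  have hC1' : (1 : ℝ) ≤ C := by exact_mod_cast hC1
  obtain ⟨K, hK⟩ := eventually_atTop.1 ((hω C).and (hreg.and
    (hytop.eventually_ge_atTop (432 * (C : ℝ)))))
  have hQ := tendsto_quadVar_of_mem hmem
  filter_upwards [hQ.eventually_ge_atTop (Real.exp t₀),
    (tendsto_logClock (t₀ := t₀) hQ).eventually_ge_atTop (t K)] with n hn1 hn2
  by_contra hcon
  rw [not_lt, normalizer_eq_exp hn1, ← logProfile_logClock (ψ := ψ) ht₀ hn1] at hcon
  obtain ⟨k, hk1, hk2⟩ := exists_grid_index httop (s := logClock S t₀ n ω)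
    (htz.trans_le (le_logClock n ω))
  have htm : StrictMono t := strictMono_nat_of_lt_succ fun k => by
    rw [htsucc]
    have := hy1 k
    have : 0 < 1 / y k := by positivity
    linarith
  have hKk : K ≤ k := Nat.lt_succ_iff.1 (htm.lt_iff_lt.1 (hn2.trans_lt hk2))
  obtain ⟨h1, h2, h3⟩ := hK k hKk
  refine (h1 n).not_ge ?_
  exact exp_le_wealth_safeBet hθ (fun s hs => hθ₀.trans (hθ hs)) hC1' h3 (hyθ k) h2 hxω h0 hC hn1
    hk1 (by rw [← htsucc]; exact hk2.le) hcon

end Upper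

/-! ### A grid adapted to a divergent integral -/

section LowerGrid

/-- The indices of `s` with `⌊f k⌋₊ = m` lie in a window of length linear in `m`, and each
contributes at most `exp (-m / 2)`. This serves to discard the grid points where the profile grows
too fast. -/
lemma summable_of_sparse_levels {f : ℕ → ℝ} (hf : ∀ k, 0 ≤ f k) (s : Set ℕ)
    (hs : ∀ k ∈ s, ∀ l ∈ s, k < l → ⌊f k⌋₊ = ⌊f l⌋₊ → l ≤ k + 8 * (⌊f l⌋₊ + 1)) :
    Summable (s.indicator fun k => Real.exp (-f k / 2)) := by
  classical
  have hb : Summable fun m : ℕ => (8 * ((m : ℝ) + 1) + 1) * Real.exp (-(m : ℝ) / 2) := by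
    have h0 := Real.summable_pow_mul_exp_neg_nat_mul 0 (show (0 : ℝ) < 1 / 2 by norm_num)
    have h1 := Real.summable_pow_mul_exp_neg_nat_mul 1 (show (0 : ℝ) < 1 / 2 by norm_num)
    refine ((h1.mul_left 8).add (h0.mul_left 9)).congr fun m => ?_
    rw [show -(1 / 2 : ℝ) * m = -(m : ℝ) / 2 by ring]
    ring
  refine summable_of_sum_le (c := ∑' m : ℕ, (8 * ((m : ℝ) + 1) + 1) * Real.exp (-(m : ℝ) / 2))
    (fun k => Set.indicator_nonneg (fun k _ => (Real.exp_pos _).le) k) fun u => ?_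
  rw [← Finset.sum_filter_add_sum_filter_not u (· ∈ s)]
  have hzero : ∑ k ∈ u.filter (· ∉ s), s.indicator (fun k => Real.exp (-f k / 2)) k = 0 :=
    Finset.sum_eq_zero fun k hk => Set.indicator_of_notMem (Finset.mem_filter.1 hk).2 _
  rw [hzero, add_zero]
  set v := u.filter (· ∈ s) with hv
  have hvs : ∀ k ∈ v, k ∈ s := fun k hk => (Finset.mem_filter.1 hk).2
  rw [← Finset.sum_fiberwise_of_maps_to (t := v.image fun k => ⌊f k⌋₊) (g := fun k => ⌊f k⌋₊)
    fun k hk => Finset.mem_image_of_mem _ hk]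
  refine le_trans (Finset.sum_le_sum fun m _ => ?_)
    (hb.sum_le_tsum (v.image fun k => ⌊f k⌋₊) fun m _ => by positivity)
  set F := v.filter fun k => ⌊f k⌋₊ = m with hF
  have hcard : (F.card : ℝ) ≤ 8 * ((m : ℝ) + 1) + 1 := by
    rcases F.eq_empty_or_nonempty with he | hne
    · rw [he]
      simp
      positivity
    · have hsub : F ⊆ Finset.Icc (F.min' hne) (F.min' hne + 8 * (m + 1)) := by
        intro l hl
        have hmin := F.min'_mem hne
        obtain ⟨hlv, hlm⟩ := Finset.mem_filter.1 hl
        obtain ⟨hkv, hkm⟩ := Finset.mem_filter.1 hmin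
        refine Finset.mem_Icc.2 ⟨F.min'_le l hl, ?_⟩
        rcases (F.min'_le l hl).eq_or_lt with h | h
        · omega
        · have := hs _ (hvs _ hkv) l (hvs _ hlv) h (hkm.trans hlm.symm)
          rwa [hlm] at this
      have := Finset.card_le_card hsub
      rw [Nat.card_Icc] at this
      have h2 : F.card ≤ 8 * (m + 1) + 1 := by omega
      exact_mod_cast h2
  calc ∑ k ∈ F, s.indicator (fun k => Real.exp (-f k / 2)) k
      ≤ ∑ k ∈ F, Real.exp (-(m : ℝ) / 2) := by
        refine Finset.sum_le_sum fun k hk => ?_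
        obtain ⟨hkv, hkm⟩ := Finset.mem_filter.1 hk
        rw [Set.indicator_of_mem (hvs k hkv)]
        refine Real.exp_le_exp.2 ?_
        have := Nat.floor_le (hf k)
        rw [hkm] at this
        linarith
    _ = F.card * Real.exp (-(m : ℝ) / 2) := by rw [Finset.sum_const, nsmul_eq_mul]
    _ ≤ _ := by gcongr

/-- Stop at the first partial sum from `k₁` on that reaches 1: the last term adds at most 1. -/
lemma exists_finset_sum_mem_Icc {w : ℕ → ℝ} {s : Set ℕ} (hw0 : ∀ k, 0 ≤ w k) (hw1 : ∀ k, w k ≤ 1)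
    (hs : ¬ Summable (s.indicator w)) (k₁ : ℕ) :
    ∃ K : Finset ℕ, (∀ k ∈ K, k ∈ s ∧ k₁ ≤ k) ∧ 1 ≤ ∑ k ∈ K, w k ∧ ∑ k ∈ K, w k ≤ 2 := by
  classical
  have hs' : ¬ Summable fun k => s.indicator w (k + k₁) := fun h => hs ((summable_nat_add_iff k₁).1 h)
  have hnn : ∀ k, 0 ≤ s.indicator w k := fun k => Set.indicator_nonneg (fun k _ => hw0 k) k
  have hle1 : ∀ k, s.indicator w k ≤ 1 := fun k => (Set.indicator_le_self' (fun k _ => hw0 k) k).trans (hw1 k)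
  have htend := (not_summable_iff_tendsto_nat_atTop_of_nonneg fun k => hnn (k + k₁)).1 hs'
  have hex : ∃ n, 1 ≤ ∑ i ∈ Finset.range n, s.indicator w (i + k₁) :=
    (htend.eventually_ge_atTop 1).exists
  have hn1 := Nat.find_spec hex
  have hpos : Nat.find hex ≠ 0 := fun h0 => by
    rw [h0] at hn1
    simp at hn1
    linarith
  obtain ⟨n, hn⟩ := Nat.exists_eq_succ_of_ne_zero hpos
  have hn2 := not_le.1 (Nat.find_min hex (show n < Nat.find hex by omega))
  rw [hn] at hn1
  have hn3 : ∑ i ∈ Finset.range (n + 1), s.indicator w (i + k₁) ≤ 2 := by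
    rw [Finset.sum_range_succ]
    linarith [hle1 (n + k₁)]
  have heq : ∑ k ∈ ((Finset.range (n + 1)).image (· + k₁)).filter (· ∈ s), w k =
      ∑ i ∈ Finset.range (n + 1), s.indicator w (i + k₁) := by
    rw [Finset.sum_filter, Finset.sum_image (by intro a _ b _ h; simpa using h)]
    refine Finset.sum_congr rfl fun i _ => ?_
    rw [Set.indicator_apply]
  refine ⟨((Finset.range (n + 1)).image (· + k₁)).filter (· ∈ s), fun k hk => ?_, ?_, ?_⟩
  · obtain ⟨h1, h2⟩ := Finset.mem_filter.1 hk
    obtain ⟨i, -, rfl⟩ := Finset.mem_image.1 h1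
    exact ⟨h2, Nat.le_add_left _ _⟩
  · rw [heq]
    exact hn1
  · rw [heq]
    exact hn3

variable {ψ : ℝ → ℝ}

/-- Converse of `ofReal_exp_le_setLIntegral`, with profile and denominator frozen at the left end of
the cell. -/
lemma setLIntegral_le_ofReal_exp (hmono : MonotoneOn ψ (Set.Ici (1 : ℝ))) {t : ℝ} (ht : 0 ≤ t)
    (h1 : 1 ≤ logProfile ψ t) :
    ∫⁻ u in Set.Ico (Real.exp t) (Real.exp (t + 1 / logProfile ψ t)),
        ENNReal.ofReal (ψ u * Real.exp (-(ψ u) ^ 2 / 2) / u) ≤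
      ENNReal.ofReal (2 * Real.exp (-(logProfile ψ t) ^ 2 / 2)) := by
  set y := logProfile ψ t with hy
  have hinv : 0 < 1 / y := by positivity
  have hinv1 : 1 / y ≤ 1 := (div_le_one (by linarith)).2 h1
  have h2 : ∫⁻ u in Set.Ico (Real.exp t) (Real.exp (t + 1 / y)),
        ENNReal.ofReal (ψ u * Real.exp (-(ψ u) ^ 2 / 2) / u) ≤
      ENNReal.ofReal (y * Real.exp (-y ^ 2 / 2) / Real.exp t) *
        volume (Set.Ico (Real.exp t) (Real.exp (t + 1 / y))) := by
    rw [← setLIntegral_const]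
    refine setLIntegral_mono' measurableSet_Ico fun u hu => ENNReal.ofReal_le_ofReal ?_
    have h3 : y ≤ ψ u := logProfile_le_of_exp_le hmono ht hu.1
    exact div_le_div₀ (by positivity) (mul_exp_neg_sq_antitone h1 h3) (Real.exp_pos _) hu.1
  refine h2.trans ?_
  rw [Real.volume_Ico, ← ENNReal.ofReal_mul (by positivity)]
  refine ENNReal.ofReal_le_ofReal ?_
  have h4 : Real.exp (1 / y) - 1 ≤ 2 * (1 / y) := by
    have := Real.abs_exp_sub_one_le (x := 1 / y) (by rwa [abs_of_pos hinv])
    rw [abs_of_pos hinv] at this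
    exact (le_abs_self _).trans this
  calc y * Real.exp (-y ^ 2 / 2) / Real.exp t * (Real.exp (t + 1 / y) - Real.exp t)
      = y * Real.exp (-y ^ 2 / 2) * (Real.exp (1 / y) - 1) := by
        rw [Real.exp_add]
        field_simp
    _ ≤ y * Real.exp (-y ^ 2 / 2) * (2 * (1 / y)) := by gcongr
    _ = 2 * Real.exp (-y ^ 2 / 2) := by field_simp

/-- The grid in the logarithmic scale with steps `1 / θ`. -/
noncomputable def grid (θ : ℝ → ℝ) (t₀ : ℝ) : ℕ → ℝ
  | 0 => t₀
  | k + 1 => grid θ t₀ k + 1 / θ (grid θ t₀ k)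

variable {θ : ℝ → ℝ} {t₀ : ℝ}

lemma grid_succ (k : ℕ) : grid θ t₀ (k + 1) = grid θ t₀ k + 1 / θ (grid θ t₀ k) := rfl

lemma le_grid (hθ : Monotone θ) (h1 : 1 ≤ θ t₀) (k : ℕ) : t₀ ≤ grid θ t₀ k := by
  induction k with
  | zero => exact le_refl _
  | succ k ih =>
    have := h1.trans (hθ ih)
    have : 0 < 1 / θ (grid θ t₀ k) := by positivity
    rw [grid_succ]
    linarith

lemma one_le_grid (hθ : Monotone θ) (h1 : 1 ≤ θ t₀) (k : ℕ) : 1 ≤ θ (grid θ t₀ k) :=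
  h1.trans (hθ (le_grid hθ h1 k))

lemma strictMono_grid (hθ : Monotone θ) (h1 : 1 ≤ θ t₀) : StrictMono (grid θ t₀) :=
  strictMono_nat_of_lt_succ fun k => by
    have := one_le_grid hθ h1 k
    have : 0 < 1 / θ (grid θ t₀ k) := by positivity
    rw [grid_succ]
    linarith

/-- Each of the `l - k` steps has length at least `1 / y`. This converts distances on the clock into
distances between indices. -/
lemma sub_le_mul_grid_sub (hθ : Monotone θ) (h1 : 1 ≤ θ t₀) {k l : ℕ} (hkl : k ≤ l) {y : ℝ}
    (hy : θ (grid θ t₀ l) ≤ y) : (l : ℝ) - k ≤ y * (grid θ t₀ l - grid θ t₀ k) := by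
  induction l, hkl using Nat.le_induction with
  | base => simp
  | succ l hkl ih =>
    have hmono := (strictMono_grid hθ h1).monotone (Nat.le_succ l)
    have h2 : θ (grid θ t₀ l) ≤ y := (hθ hmono).trans hy
    have h3 := ih h2
    have h4 := one_le_grid hθ h1 l
    have h5 : 1 ≤ y * (1 / θ (grid θ t₀ l)) := by
      rw [mul_one_div, one_le_div (by linarith)]
      exact h2
    rw [grid_succ]
    push_cast
    linarith

lemma tendsto_grid (hθ : Monotone θ) (h1 : 1 ≤ θ t₀) : Tendsto (grid θ t₀) atTop atTop := by
  refine tendsto_atTop_atTop_of_monotone (strictMono_grid hθ h1).monotone fun T => ?_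
  by_contra! hcon
  obtain ⟨n, hn⟩ := exists_nat_gt (θ T * (T - t₀))
  have h2 := sub_le_mul_grid_sub hθ h1 (Nat.zero_le n) (hθ (hcon n).le)
  have h3 : 1 ≤ θ T := (one_le_grid hθ h1 n).trans (hθ (hcon n).le)
  have h4 : θ T * (grid θ t₀ n - grid θ t₀ 0) ≤ θ T * (T - t₀) := by
    have : grid θ t₀ 0 = t₀ := rfl
    rw [this]
    have := hcon n
    gcongr
  simp only [Nat.cast_zero, sub_zero] at h2
  linarith

/-- Grid points around which the profile does not vary much. -/
def regularIndices (θ : ℝ → ℝ) (t₀ : ℝ) : Set ℕ :=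
  {k | θ (grid θ t₀ k + 5) ^ 2 ≤ θ (grid θ t₀ k) ^ 2 + 1 ∧
    θ (grid θ t₀ k) ≤ 3 * θ (grid θ t₀ k - 8 * Real.log (θ (grid θ t₀ k)))}

lemma summable_compl_regularIndices (hθ : Monotone θ) (h1 : 1 ≤ θ t₀) :
    Summable ((regularIndices θ t₀)ᶜ.indicator fun k => Real.exp (-θ (grid θ t₀ k) ^ 2 / 2)) := by
  have hone := one_le_grid hθ h1
  have hnat : ∀ k l : ℕ, (l : ℝ) - k ≤ 8 * θ (grid θ t₀ l) ^ 2 →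
      l ≤ k + 8 * (⌊θ (grid θ t₀ l) ^ 2⌋₊ + 1) := by
    intro k l h
    have h2 := Nat.lt_floor_add_one (θ (grid θ t₀ l) ^ 2)
    have h3 : (l : ℝ) < k + 8 * (⌊θ (grid θ t₀ l) ^ 2⌋₊ + 1) := by linarith
    exact_mod_cast h3.le
  -- Within 5 units of time after such a point, `θ²` leaves its integer level, so the later points
  -- of the same level have index distance at most `5 θ`.
  have hA := summable_of_sparse_levels (f := fun k => θ (grid θ t₀ k) ^ 2) (fun k => sq_nonneg _)
    {k | θ (grid θ t₀ k) ^ 2 + 1 < θ (grid θ t₀ k + 5) ^ 2} (by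
      intro k hk l _ hkl hfl
      have hk : θ (grid θ t₀ k) ^ 2 + 1 < θ (grid θ t₀ k + 5) ^ 2 := hk
      have h2 := Nat.floor_le (sq_nonneg (θ (grid θ t₀ k)))
      have h3 := Nat.lt_floor_add_one (θ (grid θ t₀ l) ^ 2)
      have h5 : grid θ t₀ l < grid θ t₀ k + 5 := by
        by_contra hcon
        have h6 := hθ (not_lt.1 hcon)
        have h7 : 0 ≤ θ (grid θ t₀ k + 5) := by
          linarith [hone k, hθ (show grid θ t₀ k ≤ grid θ t₀ k + 5 by linarith)]
        have h8 := pow_le_pow_left₀ h7 h6 2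
        rw [← hfl] at h3
        linarith
      refine hnat k l ?_
      have h9 := sub_le_mul_grid_sub hθ h1 hkl.le (le_refl (θ (grid θ t₀ l)))
      nlinarith [hone l])
  -- Here the later index `l` is the bad one: at times before `t_l - 8 log θ(t_l)` the profile is
  -- less than a third of its value at `t_l`, which is incompatible with the same integer level of
  -- `θ²`.
  have hB := summable_of_sparse_levels (f := fun k => θ (grid θ t₀ k) ^ 2) (fun k => sq_nonneg _)
    {k | 3 * θ (grid θ t₀ k - 8 * Real.log (θ (grid θ t₀ k))) < θ (grid θ t₀ k)} (by
      intro k _ l hl hkl hfl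
      have hl : 3 * θ (grid θ t₀ l - 8 * Real.log (θ (grid θ t₀ l))) < θ (grid θ t₀ l) := hl
      have h2 := Nat.floor_le (sq_nonneg (θ (grid θ t₀ k)))
      have h3 := Nat.lt_floor_add_one (θ (grid θ t₀ l) ^ 2)
      have h5 : grid θ t₀ l - grid θ t₀ k < 8 * Real.log (θ (grid θ t₀ l)) := by
        by_contra hcon
        have h6 := hθ (show grid θ t₀ k ≤ grid θ t₀ l - 8 * Real.log (θ (grid θ t₀ l)) by linarith)
        rw [← hfl] at h3
        nlinarith [hone k, hone l]
      refine hnat k l ?_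
      have h9 := sub_le_mul_grid_sub hθ h1 hkl.le (le_refl (θ (grid θ t₀ l)))
      have h10 := Real.log_le_sub_one_of_pos (by linarith [hone l] : 0 < θ (grid θ t₀ l))
      nlinarith [hone l])
  refine (hA.add hB).of_nonneg_of_le (fun k => Set.indicator_nonneg (fun _ _ => (Real.exp_pos _).le) _)
    fun k => ?_
  have hnnA := Set.indicator_nonneg (s := {k | θ (grid θ t₀ k) ^ 2 + 1 < θ (grid θ t₀ k + 5) ^ 2})
    (f := fun k => Real.exp (-θ (grid θ t₀ k) ^ 2 / 2)) (fun _ _ => (Real.exp_pos _).le) k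
  have hnnB := Set.indicator_nonneg
    (s := {k | 3 * θ (grid θ t₀ k - 8 * Real.log (θ (grid θ t₀ k))) < θ (grid θ t₀ k)})
    (f := fun k => Real.exp (-θ (grid θ t₀ k) ^ 2 / 2)) (fun _ _ => (Real.exp_pos _).le) k
  by_cases hk : k ∈ (regularIndices θ t₀)ᶜ
  · rw [Set.indicator_of_mem hk]
    rcases not_and_or.1 hk with h | h
    · have hmem : k ∈ {k | θ (grid θ t₀ k) ^ 2 + 1 < θ (grid θ t₀ k + 5) ^ 2} := not_le.1 h
      rw [Set.indicator_of_mem hmem]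
      linarith
    · have hmem : k ∈ {k | 3 * θ (grid θ t₀ k - 8 * Real.log (θ (grid θ t₀ k))) <
          θ (grid θ t₀ k)} := not_le.1 h
      rw [Set.indicator_of_mem hmem]
      linarith
  · rw [Set.indicator_of_notMem hk]
    linarith

/-- Otherwise the weights over all grid points would be summable, the irregular ones being so
anyway; the cells and the bounded initial segment cover `[1, ∞)`, and the integral would be finite.
-/
lemma not_summable_regularIndices (hpos : ∀ t ∈ Set.Ici (1 : ℝ), 0 < ψ t)
    (hmono : MonotoneOn ψ (Set.Ici (1 : ℝ))) (hI : efkpIntegral ψ = ⊤) (ht₀ : 0 ≤ t₀)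
    (h1 : 1 ≤ logProfile ψ t₀) :
    ¬ Summable ((regularIndices (logProfile ψ) t₀).indicator
      fun k => Real.exp (-logProfile ψ (grid (logProfile ψ) t₀ k) ^ 2 / 2)) := by
  intro hgood
  have hθ := monotone_logProfile hpos hmono
  have hsum := hgood.add (summable_compl_regularIndices hθ h1)
  simp only [Set.indicator_self_add_compl_apply] at hsum
  set θ := logProfile ψ with hθdef
  have hfirst : ∫⁻ u in Set.Ico 1 (Real.exp t₀),
      ENNReal.ofReal (ψ u * Real.exp (-(ψ u) ^ 2 / 2) / u) < ⊤ := by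
    refine lt_of_le_of_lt (setLIntegral_mono' measurableSet_Ico (g := fun _ =>
      ENNReal.ofReal (ψ (Real.exp t₀))) fun u hu => ENNReal.ofReal_le_ofReal ?_) ?_
    · have hu1 : (1 : ℝ) ≤ u := hu.1
      have h2 : ψ u ≤ ψ (Real.exp t₀) := hmono hu1 (Real.one_le_exp ht₀) hu.2.le
      have h3 : 0 < ψ u := hpos u hu1
      have h4 : Real.exp (-(ψ u) ^ 2 / 2) ≤ 1 := Real.exp_le_one_iff.2 (by nlinarith)
      rw [div_le_iff₀ (by linarith)]
      calc ψ u * Real.exp (-(ψ u) ^ 2 / 2) ≤ ψ u * 1 := by gcongr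
        _ ≤ ψ (Real.exp t₀) * u := by
          have : 0 < ψ (Real.exp t₀) := by linarith
          gcongr
    · rw [setLIntegral_const, Real.volume_Ico]
      exact ENNReal.mul_lt_top ENNReal.ofReal_lt_top ENNReal.ofReal_lt_top
  have hrest : ∫⁻ u in ⋃ k, Set.Ico (Real.exp (grid θ t₀ k)) (Real.exp (grid θ t₀ (k + 1))),
      ENNReal.ofReal (ψ u * Real.exp (-(ψ u) ^ 2 / 2) / u) < ⊤ := by
    rw [lintegral_iUnion (fun _ => measurableSet_Ico)]
    · refine lt_of_le_of_lt (ENNReal.tsum_le_tsum fun k => ?_)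
        ((hsum.mul_left 2).tsum_ofReal_ne_top.lt_top)
      exact setLIntegral_le_ofReal_exp hmono (ht₀.trans (le_grid hθ h1 k)) (one_le_grid hθ h1 k)
    · exact Monotone.pairwise_disjoint_on_Ico_succ (f := fun k => Real.exp (grid θ t₀ k))
        (Real.exp_monotone.comp (strictMono_grid hθ h1).monotone)
  have hcover : Set.Ici (1 : ℝ) ⊆ Set.Ico 1 (Real.exp t₀) ∪
      ⋃ k, Set.Ico (Real.exp (grid θ t₀ k)) (Real.exp (grid θ t₀ (k + 1))) := by
    intro u hu
    have hu1 : (1 : ℝ) ≤ u := hu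
    rcases lt_or_ge u (Real.exp t₀) with h | h
    · exact Or.inl ⟨hu1, h⟩
    · obtain ⟨j, hj1, hj2⟩ := exists_grid_index (tendsto_grid hθ h1) (s := Real.log u)
        ((Real.le_log_iff_exp_le (by linarith)).2 h)
      exact Or.inr (Set.mem_iUnion.2 ⟨j, (Real.le_log_iff_exp_le (by linarith)).1 hj1,
        (Real.log_lt_iff_lt_exp (by linarith)).1 hj2⟩)
  have : efkpIntegral ψ < ⊤ :=
    (lintegral_mono_set hcover).trans_lt
      ((lintegral_union_le _ _ _).trans_lt (ENNReal.add_lt_top.2 ⟨hfirst, hrest⟩))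
  exact this.ne hI

lemma exists_sum_exp_neg_abs_le :
    ∃ B : ℝ, 0 ≤ B ∧ ∀ (K : Finset ℕ) (k₀ : ℕ),
      ∑ k ∈ K, Real.exp (1 - |(k : ℝ) - k₀| / 64) ≤ B := by
  have hs : Summable fun n : ℤ => Real.exp (1 - |(n : ℝ)| / 64) := by
    have h0 := (Real.summable_pow_mul_exp_neg_nat_mul 0
      (show (0 : ℝ) < 1 / 64 by norm_num)).mul_left (Real.exp 1)
    have h1 : Summable fun n : ℕ => Real.exp (1 - |((n : ℤ) : ℝ)| / 64) := by
      refine h0.congr fun n => ?_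
      rw [pow_zero, one_mul, ← Real.exp_add]
      simp
      ring
    exact Summable.of_nat_of_neg h1 (h1.congr fun n => by simp)
  refine ⟨∑' n : ℤ, Real.exp (1 - |(n : ℝ)| / 64), tsum_nonneg fun n => (Real.exp_pos _).le,
    fun K k₀ => ?_⟩
  have hinj : Set.InjOn (fun k : ℕ => (k : ℤ) - k₀) K := fun a _ b _ h => by
    simpa using h
  calc ∑ k ∈ K, Real.exp (1 - |(k : ℝ) - k₀| / 64)
      = ∑ n ∈ K.image fun k : ℕ => (k : ℤ) - k₀, Real.exp (1 - |(n : ℝ)| / 64) := by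
        rw [Finset.sum_image hinj]
        push_cast
        rfl
    _ ≤ _ := hs.sum_le_tsum _ fun n _ => (Real.exp_pos _).le

/-- Away from the grid point that matches the clock, the Gaussian exponent decays linearly in the
index, unless the grid point is so remote that its bet is still negligible. -/
lemma gaussian_exponent_le (hθ : Monotone θ) (h1 : 1 ≤ θ t₀) {h : ℝ} {k k₀ : ℕ}
    (hk₀ : grid θ t₀ k₀ ≤ h) (hk₀' : h < grid θ t₀ (k₀ + 1))
    (hk : θ (grid θ t₀ k + 5) ^ 2 ≤ θ (grid θ t₀ k) ^ 2 + 1)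
    (hact : h ≤ grid θ t₀ k + Real.log 64) :
    -(θ (grid θ t₀ k) ^ 2 * (Real.exp ((h - grid θ t₀ k) / 2) - 1) ^ 2 / 2) ≤
        1 - |(k : ℝ) - k₀| / 64 ∨
      (h ≤ grid θ t₀ k ∧ θ (grid θ t₀ k) ^ 2 * Real.exp ((h - grid θ t₀ k) / 2) ≤ 1) := by
  have hone := one_le_grid hθ h1
  have hmono := (strictMono_grid hθ h1).monotone
  set D := θ (grid θ t₀ k) with hD
  have hD1 : 1 ≤ D := hone k
  have hlog64 : Real.log 64 ≤ 5 := by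
    rw [Real.log_le_iff_le_exp (by norm_num)]
    have : Real.exp 5 = Real.exp 1 ^ 5 := by rw [← Real.exp_nat_mul]; norm_num
    rw [this]
    have := pow_le_pow_left₀ (by norm_num) Real.exp_one_gt_d9.le 5
    refine le_trans (by norm_num) this
  rcases Nat.lt_or_ge k₀ k with hlt | hge
  · have hkt : grid θ t₀ (k₀ + 1) ≤ grid θ t₀ k := hmono hlt
    set v := (grid θ t₀ k - h) / 2 with hv
    have hv0 : 0 < v := by linarith
    rw [show (h - grid θ t₀ k) / 2 = -v by rw [hv]; ring]
    have habs : |(k : ℝ) - k₀| = k - k₀ :=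
      abs_of_nonneg (sub_nonneg.2 (by exact_mod_cast hlt.le))
    have hj : (k : ℝ) - k₀ ≤ 1 + 2 * D * v := by
      have h2 := sub_le_mul_grid_sub hθ h1 (show k₀ + 1 ≤ k by omega) (le_refl D)
      push_cast at h2
      have h3 : D * (grid θ t₀ k - grid θ t₀ (k₀ + 1)) ≤ D * (2 * v) := by
        gcongr
        linarith
      linarith
    rw [habs]
    set r := Real.exp (-v) with hr
    have hr0 : 0 < r := Real.exp_pos _
    by_cases hneg : D ^ 2 * r ≤ 1
    · exact Or.inr ⟨by linarith, hneg⟩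
    left
    have hrv : (1 + v) * r ≤ 1 := by
      calc (1 + v) * r ≤ Real.exp v * r := by
            gcongr
            linarith [Real.add_one_le_exp v]
        _ = 1 := by rw [hr, ← Real.exp_add]; simp
    rcases le_total v 1 with hv1 | hv1
    · have h4 : v / 2 ≤ 1 - r := by nlinarith
      have h5 : (D * (v / 2)) ^ 2 ≤ (D * (1 - r)) ^ 2 :=
        pow_le_pow_left₀ (by positivity) (mul_le_mul_of_nonneg_left h4 (by linarith)) 2
      nlinarith [sq_nonneg (D * v - 2), mul_pos (by linarith : 0 < D) hv0]
    · have h4 : 1 / 2 ≤ 1 - r := by nlinarith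
      have h5 : (D * (1 / 2)) ^ 2 ≤ (D * (1 - r)) ^ 2 :=
        pow_le_pow_left₀ (by positivity) (mul_le_mul_of_nonneg_left h4 (by linarith)) 2
      -- Since the bet is not negligible, `exp v < D²`, so `v` is at most logarithmic in `D` and the
      -- index distance is at most of order `D²`, which the Gaussian term of order `D²` controls.
      have h6 : v ≤ 2 * D := by
        have h7 : Real.exp v < D ^ 2 := by
          have h8 : Real.exp v * r = 1 := by rw [hr, ← Real.exp_add]; simp
          have h9 := Real.exp_pos v
          nlinarith
        have h8 : v < 2 * Real.log D := by
          have := (Real.lt_log_iff_exp_lt (by positivity)).2 h7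
          rwa [Real.log_pow, Nat.cast_ofNat] at this
        linarith [Real.log_le_sub_one_of_pos (by linarith : 0 < D)]
      have h7 : D * v ≤ 2 * D ^ 2 := by nlinarith
      nlinarith
  · left
    have hkt : grid θ t₀ k ≤ grid θ t₀ k₀ := hmono hge
    set u := (h - grid θ t₀ k) / 2 with hu
    have hu0 : 0 ≤ u := by linarith
    have habs : |(k : ℝ) - k₀| = k₀ - k := by
      rw [abs_sub_comm]
      exact abs_of_nonneg (sub_nonneg.2 (by exact_mod_cast hge))
    -- The clock is at most `log 64 ≤ 5` past level `k`, so regularity keeps the grid steps in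
    -- between at least `1 / (2 D)`.
    have hθh : θ (grid θ t₀ k₀) ≤ 2 * D := by
      have h2 : θ (grid θ t₀ k₀) ≤ θ (grid θ t₀ k + 5) := hθ (by linarith)
      have h3 := hone k₀
      nlinarith
    have hj : (k₀ : ℝ) - k ≤ 4 * D * u := by
      have h2 := sub_le_mul_grid_sub hθ h1 hge hθh
      have h3 : 2 * D * (grid θ t₀ k₀ - grid θ t₀ k) ≤ 2 * D * (2 * u) := by
        gcongr
        linarith
      linarith
    rw [habs]
    have h4 : u ≤ Real.exp u - 1 := by linarith [Real.add_one_le_exp u]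
    have h5 : (D * u) ^ 2 ≤ (D * (Real.exp u - 1)) ^ 2 :=
      pow_le_pow_left₀ (by positivity) (mul_le_mul_of_nonneg_left h4 (by linarith)) 2
    nlinarith [sq_nonneg (D * u - 1), mul_nonneg (by linarith : 0 ≤ D) hu0]

end LowerGrid

/-! ### Total wealth of the bettors below the boundary -/

section Lower

variable {Ω : Type*} {S c : ℕ → Ω → ℝ} {θ : ℝ → ℝ} {t₀ C L : ℝ} {N : ℕ}

/-- The paths that stay below the boundary `θ` between the times `N` and `i`, and whose announced
bounds are small compared with the clock up to time `i`. -/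
def admissible (S c : ℕ → Ω → ℝ) (θ : ℝ → ℝ) (t₀ C : ℝ) (N i : ℕ) : Set Ω :=
  {ω | (∀ j ≤ i, N ≤ j →
      S j ω < Real.exp (logClock S t₀ j ω / 2) * θ (logClock S t₀ j ω)) ∧
    ∀ j ≤ i, c (j + 1) ω * θ (logClock S t₀ j ω) ^ 3 ≤ C * Real.exp (logClock S t₀ j ω / 2)}

/-- The bet of level `τ`: constant while the path is admissible and the clock is below
`τ + log 64`. -/
noncomputable def levelBet (S c : ℕ → Ω → ℝ) (θ : ℝ → ℝ) (t₀ C : ℝ) (N : ℕ) (τ : ℝ) (i : ℕ)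
    (ω : Ω) : ℝ :=
  {ω | N ≤ i ∧ ω ∈ admissible S c θ t₀ C N i ∧ logClock S t₀ i ω ≤ τ + Real.log 64}.indicator
    (fun _ => θ τ / Real.exp (τ / 2)) ω

/-- Conditions on a level `τ` for its bet to be efficient. -/
structure GoodLevel (θ : ℝ → ℝ) (t₀ C L τ : ℝ) : Prop where
  nonneg : 0 ≤ τ
  le_add_one : θ (τ + 5) ^ 2 ≤ θ τ ^ 2 + 1
  le_three_mul : θ τ ≤ 3 * θ (τ - 8 * Real.log (θ τ))
  large : 432 * C ≤ θ τ
  remote : θ τ * (L + Real.exp t₀) ≤ Real.exp (τ / 2)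

lemma admissible_antitone {i j : ℕ} (hij : i ≤ j) :
    admissible S c θ t₀ C N j ⊆ admissible S c θ t₀ C N i :=
  fun _ hω => ⟨fun l hl => hω.1 l (hl.trans hij), fun l hl => hω.2 l (hl.trans hij)⟩

lemma levelBet_of_mem {τ : ℝ} {i : ℕ} {ω : Ω} (hN : N ≤ i)
    (h1 : ω ∈ admissible S c θ t₀ C N i) (h2 : logClock S t₀ i ω ≤ τ + Real.log 64) :
    levelBet S c θ t₀ C N τ i ω = θ τ / Real.exp (τ / 2) :=
  Set.indicator_of_mem (s := {ω | N ≤ i ∧ ω ∈ admissible S c θ t₀ C N i ∧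
    logClock S t₀ i ω ≤ τ + Real.log 64}) ⟨hN, h1, h2⟩ _

lemma levelBet_of_not {τ : ℝ} {i : ℕ} {ω : Ω}
    (h : ¬ (N ≤ i ∧ ω ∈ admissible S c θ t₀ C N i ∧ logClock S t₀ i ω ≤ τ + Real.log 64)) :
    levelBet S c θ t₀ C N τ i ω = 0 :=
  Set.indicator_of_notMem (s := {ω | N ≤ i ∧ ω ∈ admissible S c θ t₀ C N i ∧
    logClock S t₀ i ω ≤ τ + Real.log 64}) h _

lemma measurableSet_admissible {mΩ : MeasurableSpace Ω} {ℱ : Filtration ℕ mΩ}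
    (hS : StronglyAdapted ℱ S) (hc : ∀ i, Measurable[ℱ i] (c (i + 1))) (hθ : Monotone θ) (i : ℕ) :
    MeasurableSet[ℱ i] (admissible S c θ t₀ C N i) := by
  have hθm := hθ.measurable
  have hclock : ∀ j ≤ i, Measurable[ℱ i] (logClock S t₀ j) := fun j hj =>
    (measurable_logClock hS j).mono (ℱ.mono hj) le_rfl
  have heq : admissible S c θ t₀ C N i =
      (⋂ j ∈ Set.Iic i, ⋂ (_ : N ≤ j), {ω | S j ω <
        Real.exp (logClock S t₀ j ω / 2) * θ (logClock S t₀ j ω)}) ∩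
      ⋂ j ∈ Set.Iic i, {ω | c (j + 1) ω * θ (logClock S t₀ j ω) ^ 3 ≤
        C * Real.exp (logClock S t₀ j ω / 2)} := by
    ext ω
    simp [admissible]
  rw [heq]
  refine MeasurableSet.inter ?_ ?_
  · refine MeasurableSet.biInter (Set.to_countable _) fun j hj => MeasurableSet.iInter fun _ => ?_
    have hj : j ≤ i := hj
    have hSj : Measurable[ℱ i] (S j) := ((hS j).mono (ℱ.mono hj)).measurable
    exact measurableSet_lt hSj ((Real.measurable_exp.comp ((hclock j hj).div_const 2)).mul
      (hθm.comp (hclock j hj)))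
  · refine MeasurableSet.biInter (Set.to_countable _) fun j hj => ?_
    have hj : j ≤ i := hj
    exact measurableSet_le (((hc j).mono (ℱ.mono hj) le_rfl).mul
      ((hθm.comp (hclock j hj)).pow_const 3))
      ((Real.measurable_exp.comp ((hclock j hj).div_const 2)).const_mul C)

lemma measurable_levelBet {mΩ : MeasurableSpace Ω} {ℱ : Filtration ℕ mΩ}
    (hS : StronglyAdapted ℱ S) (hc : ∀ i, Measurable[ℱ i] (c (i + 1))) (hθ : Monotone θ) (τ : ℝ)
    (i : ℕ) : Measurable[ℱ i] (levelBet S c θ t₀ C N τ i) := by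
  have hset : MeasurableSet[ℱ i] {ω | N ≤ i ∧ ω ∈ admissible S c θ t₀ C N i ∧
      logClock S t₀ i ω ≤ τ + Real.log 64} := by
    refine (MeasurableSet.const _).inter ((measurableSet_admissible hS hc hθ i).inter ?_)
    exact measurableSet_le (measurable_logClock hS i) measurable_const
  exact Measurable.indicator measurable_const hset

lemma GoodLevel.mul_le {τ : ℝ} (hτ : GoodLevel θ t₀ C L τ) (hθ : Monotone θ) (hC : 1 ≤ C)
    (hθ1 : 1 ≤ θ t₀) {ω : Ω} (hx : ∀ i, |S (i + 1) ω - S i ω| ≤ c (i + 1) ω) {i : ℕ}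
    (hadm : ω ∈ admissible S c θ t₀ C N i) (hact : logClock S t₀ i ω ≤ τ + Real.log 64) :
    θ τ / Real.exp (τ / 2) * c (i + 1) ω ≤ 216 * C / θ τ ^ 2 :=
  bet_mul_le hθ hC (by linarith [hτ.large]) hτ.le_three_mul hact ((abs_nonneg _).trans (hx i))
    (hθ1.trans (hθ (le_logClock i ω))) (hadm.2 i le_rfl)

lemma GoodLevel.delta_le {τ : ℝ} (hτ : GoodLevel θ t₀ C L τ) (hC : 1 ≤ C) :
    216 * C / θ τ ^ 2 ≤ 1 / 2 := by
  have h := hτ.large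
  rw [div_le_iff₀ (by nlinarith)]
  nlinarith

lemma GoodLevel.abs_levelBet_mul_le {τ : ℝ} (hτ : GoodLevel θ t₀ C L τ) (hθ : Monotone θ)
    (hC : 1 ≤ C) (hθ1 : 1 ≤ θ t₀) {ω : Ω} (hx : ∀ i, |S (i + 1) ω - S i ω| ≤ c (i + 1) ω) (i : ℕ) :
    |levelBet S c θ t₀ C N τ i ω * (S (i + 1) ω - S i ω)| ≤ 1 / 2 := by
  by_cases h : N ≤ i ∧ ω ∈ admissible S c θ t₀ C N i ∧ logClock S t₀ i ω ≤ τ + Real.log 64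
  · have hD : 0 < θ τ := by linarith [hτ.large]
    have hlam : 0 ≤ θ τ / Real.exp (τ / 2) := by positivity
    rw [levelBet_of_mem h.1 h.2.1 h.2.2, abs_mul, abs_of_nonneg hlam]
    exact ((mul_le_mul_of_nonneg_left (hx i) hlam).trans (hτ.mul_le hθ hC hθ1 hx h.2.1 h.2.2)).trans
      (hτ.delta_le hC)
  · rw [levelBet_of_not h]
    norm_num

lemma wealth_eq_of_eq_zero {b : ℕ → Ω → ℝ} {m n : ℕ} (hmn : m ≤ n) {ω : Ω}
    (h : ∀ i, m ≤ i → i < n → b i ω = 0) : wealth S b n ω = wealth S b m ω := by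
  induction n, hmn using Nat.le_induction with
  | base => rfl
  | succ n hmn ih =>
    rw [wealth_succ, ih fun i h1 h2 => h i h1 (by omega), h n hmn (by omega)]
    simp

lemma exp_logClock_le_of_active {τ : ℝ} (hτ : GoodLevel θ t₀ C L τ) (hθ : Monotone θ) (hC : 1 ≤ C)
    (hθ1 : 1 ≤ θ t₀) {ω : Ω} (hx : ∀ i, |S (i + 1) ω - S i ω| ≤ c (i + 1) ω)
    (hQN : quadVar S N ω ≤ L) {n : ℕ} (hn : N ≤ n)
    (hact : ∀ i, N ≤ i → i < n →
      ω ∈ admissible S c θ t₀ C N i ∧ logClock S t₀ i ω ≤ τ + Real.log 64) :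
    Real.exp (logClock S t₀ n ω) ≤ 65 * Real.exp τ := by
  have hD : 432 ≤ θ τ := by linarith [hτ.large]
  rcases hn.eq_or_lt with rfl | hlt
  · have h1 := exp_logClock_le (S := S) (t₀ := t₀) N ω
    have h2 : L + Real.exp t₀ ≤ Real.exp (τ / 2) := by
      refine le_trans ?_ hτ.remote
      have := (quadVar_nonneg (S := S) N ω).trans hQN
      exact le_mul_of_one_le_left (by positivity) (by linarith)
    have h3 : Real.exp (τ / 2) ≤ Real.exp τ := Real.exp_le_exp.2 (by linarith [hτ.nonneg])
    linarith [Real.exp_pos τ]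
  -- The last active step starts below `64 exp τ` and adds a square of at most `exp τ`, which gives
  -- 65.
  · obtain ⟨m, rfl⟩ := Nat.exists_eq_succ_of_ne_zero (show n ≠ 0 by omega)
    obtain ⟨h1, h2⟩ := hact m (by omega) (Nat.lt_succ_self m)
    have h3 := exp_logClock_succ_le (S := S) (t₀ := t₀) m ω
    have h4 : Real.exp (logClock S t₀ m ω) ≤ 64 * Real.exp τ := by
      have := Real.exp_le_exp.2 h2
      rwa [Real.exp_add, Real.exp_log (by norm_num), mul_comm] at this
    have h5 := (hτ.mul_le hθ hC hθ1 hx h1 h2).trans (hτ.delta_le hC)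
    have h6 : |S (m + 1) ω - S m ω| ≤ Real.exp (τ / 2) := by
      refine (hx m).trans ?_
      rw [div_mul_eq_mul_div, div_le_iff₀ (Real.exp_pos _)] at h5
      have := (abs_nonneg _).trans (hx m)
      nlinarith [Real.exp_pos (τ / 2)]
    have h7 : (S (m + 1) ω - S m ω) ^ 2 ≤ Real.exp τ := by
      have h8 : Real.exp τ = Real.exp (τ / 2) ^ 2 := by
        rw [← Real.exp_nat_mul]
        ring_nf
      rw [h8, ← sq_abs]
      exact pow_le_pow_left₀ (abs_nonneg _) h6 2
    simp only [Nat.succ_eq_add_one]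
    linarith

/-- The wealth of the bettor of level `τ` at a time when the boundary has not been crossed. -/
lemma wealth_levelBet_le {τ : ℝ} (hτ : GoodLevel θ t₀ C L τ) (hθ : Monotone θ) (hC : 1 ≤ C)
    (ht₀ : 0 ≤ t₀) (hθ1 : 1 ≤ θ t₀) {ω : Ω} (hx : ∀ i, |S (i + 1) ω - S i ω| ≤ c (i + 1) ω)
    (hSN : |S N ω| ≤ L) (hQN : quadVar S N ω ≤ L) {n : ℕ} (hn : N ≤ n)
    (hact : ∀ i, N ≤ i → i < n →
      ω ∈ admissible S c θ t₀ C N i ∧ logClock S t₀ i ω ≤ τ + Real.log 64)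
    (hcross : S n ω < Real.exp (logClock S t₀ n ω / 2) * θ (logClock S t₀ n ω)) :
    wealth S (levelBet S c θ t₀ C N τ) n ω ≤
        Real.exp (8 + 28080 * C) * Real.exp (θ τ ^ 2 / 2 -
          θ τ ^ 2 * (Real.exp ((logClock S t₀ n ω - τ) / 2) - 1) ^ 2 / 2) ∧
      (logClock S t₀ n ω ≤ τ → wealth S (levelBet S c θ t₀ C N τ) n ω ≤
        Real.exp (8 + 28080 * C) *
          Real.exp (θ τ ^ 2 * Real.exp ((logClock S t₀ n ω - τ) / 2))) := by
  set D := θ τ with hD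
  have hDlarge : 432 * C ≤ D := hτ.large
  have hD1 : 432 ≤ D := by linarith
  set lam := D / Real.exp (τ / 2) with hlam
  have hlam0 : 0 < lam := by positivity
  set δ := 216 * C / D ^ 2 with hδ
  have hδ2 : δ ≤ 1 / 2 := hτ.delta_le hC
  have hδ0 : 0 ≤ δ := by positivity
  set h := logClock S t₀ n ω with hh
  set r := Real.exp ((h - τ) / 2) with hr
  have hr0 : 0 < r := Real.exp_pos _
  have hwealth : wealth S (levelBet S c θ t₀ C N τ) n ω =
      ∏ i ∈ Finset.Ico N n, (1 + lam * (S (i + 1) ω - S i ω)) := by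
    rw [wealth, Finset.range_eq_Ico, ← Finset.prod_Ico_consecutive _ (Nat.zero_le N) hn]
    rw [Finset.prod_eq_one (s := Finset.Ico 0 N), one_mul]
    · refine Finset.prod_congr rfl fun i hi => ?_
      obtain ⟨h1, h2⟩ := Finset.mem_Ico.1 hi
      rw [levelBet_of_mem h1 (hact i h1 h2).1 (hact i h1 h2).2]
    · intro i hi
      rw [levelBet_of_not fun hcon => absurd hcon.1 (by have := (Finset.mem_Ico.1 hi).2; omega)]
      simp
  have hbound := prod_one_add_le_exp (Finset.Ico N n) (fun i => lam * (S (i + 1) ω - S i ω)) hδ2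
    fun i hi => by
      obtain ⟨h1, h2⟩ := Finset.mem_Ico.1 hi
      rw [abs_mul, abs_of_pos hlam0]
      exact (mul_le_mul_of_nonneg_left (hx i) hlam0.le).trans
        (hτ.mul_le hθ hC hθ1 hx (hact i h1 h2).1 (hact i h1 h2).2)
  rw [← hwealth] at hbound
  simp only [mul_pow] at hbound
  rw [← Finset.mul_sum, ← Finset.mul_sum, Finset.sum_Ico_eq_sub _ hn, Finset.sum_Ico_eq_sub _ hn,
    Finset.sum_range_sub (fun i => S i ω), Finset.sum_range_sub (fun i => S i ω),
    ← quadVar_eq_sum_range, ← quadVar_eq_sum_range] at hbound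
  have e1 : lam * Real.exp (h / 2) = D * r := by
    rw [hlam, hr, sub_div, Real.exp_sub]
    field_simp
  have e2 : lam ^ 2 * Real.exp h = D ^ 2 * r ^ 2 := by
    have : Real.exp h = Real.exp (h / 2) ^ 2 := by
      rw [← Real.exp_nat_mul]
      ring_nf
    rw [this, ← mul_pow, e1, mul_pow]
  have e3 : r ^ 2 ≤ 65 := by
    have h1 := exp_logClock_le_of_active hτ hθ hC hθ1 hx hQN hn hact
    have h2 : r ^ 2 = Real.exp h / Real.exp τ := by
      rw [hr, ← Real.exp_nat_mul, ← Real.exp_sub]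
      ring_nf
    rw [h2, div_le_iff₀ (Real.exp_pos _)]
    exact h1
  have e4 : r ≤ 9 := by nlinarith
  have hQ0 := quadVar_nonneg (S := S) N ω
  have hQn := quadVar_le_exp_logClock (S := S) (t₀ := t₀) n ω
  have hQn' := exp_logClock_le (S := S) (t₀ := t₀) n ω
  have e5 : lam * (L + Real.exp t₀) ≤ 1 := by
    rw [hlam, div_mul_eq_mul_div, div_le_one (Real.exp_pos _)]
    exact hτ.remote
  have hexp1 : 1 ≤ Real.exp t₀ := Real.one_le_exp ht₀
  have hL0 : 0 ≤ L := hQ0.trans hQN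
  have e6 : lam ≤ 1 := by nlinarith
  have e7 : lam ^ 2 * (L + Real.exp t₀) ≤ 1 := by
    calc lam ^ 2 * (L + Real.exp t₀) = lam * (lam * (L + Real.exp t₀)) := by ring
      _ ≤ 1 * 1 := by gcongr
      _ = 1 := one_mul 1
  have e8 : -(lam * S N ω) ≤ 1 := by
    have h1 := (abs_le.1 hSN).1
    nlinarith
  have e9 : 2 * δ * (lam ^ 2 * (quadVar S n ω - quadVar S N ω)) ≤ 28080 * C := by
    calc 2 * δ * (lam ^ 2 * (quadVar S n ω - quadVar S N ω))
        ≤ 2 * δ * (lam ^ 2 * Real.exp h) := by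
          gcongr
          linarith
      _ = 432 * C * r ^ 2 := by
          rw [e2, hδ]
          field_simp
          ring
      _ ≤ 432 * C * 65 := by gcongr
      _ = 28080 * C := by ring
  have e10 : lam ^ 2 * Real.exp h ≤ lam ^ 2 * (quadVar S n ω + Real.exp t₀) := by gcongr
  have e11 : lam ^ 2 * quadVar S N ω ≤ lam ^ 2 * L := by gcongr
  have e12 : lam * S n ω ≤ D * r * θ h := by
    calc lam * S n ω ≤ lam * (Real.exp (h / 2) * θ h) := by gcongr
      _ = D * r * θ h := by rw [← mul_assoc, e1]
  -- The term 2 absorbs the values at time `N` and the truncation of the clock, negligible because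
  -- the level is remote; `28080 = 432 * 65` comes from the cubic error.
  have hmain : lam * (S n ω - S 0 ω - (S N ω - S 0 ω)) -
      lam ^ 2 * (quadVar S n ω - quadVar S N ω) / 2 +
      2 * δ * (lam ^ 2 * (quadVar S n ω - quadVar S N ω)) ≤
      D * r * θ h - D ^ 2 * r ^ 2 / 2 + 2 + 28080 * C := by
    rw [e2] at e10
    linarith
  -- Replaces `θ h` by `D = θ τ`: below `τ` by monotonicity, above `τ` because `θ²` grows by at most
  -- 1 over the active range, which costs at most `r / 2 ≤ 9 / 2`.
  have hθle : D * r * θ h ≤ D ^ 2 * r + 5 := by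
    rcases le_total h τ with hle | hle
    · have h1 : θ h ≤ D := hθ hle
      have h2 : D * r * θ h ≤ D * r * D := by gcongr
      linarith
    · have hle5 : h ≤ τ + 5 := by
        have h1 : Real.exp (h - τ) ≤ Real.exp 5 := by
          have h2 : r ^ 2 = Real.exp (h - τ) := by
            rw [hr, ← Real.exp_nat_mul]
            ring_nf
          rw [← h2]
          refine e3.trans ?_
          have h3 : Real.exp 5 = Real.exp 1 ^ 5 := by rw [← Real.exp_nat_mul]; norm_num
          rw [h3]
          exact le_trans (by norm_num) (pow_le_pow_left₀ (by norm_num) Real.exp_one_gt_d9.le 5)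
        linarith [Real.exp_le_exp.1 h1]
      have h1 : θ h ≤ θ (τ + 5) := hθ hle5
      have h2 : D ≤ θ h := hθ hle
      have h3 : θ h ^ 2 ≤ D ^ 2 + 1 :=
        (pow_le_pow_left₀ (by linarith) h1 2).trans hτ.le_add_one
      have h4 : D * θ h ≤ D ^ 2 + 1 / 2 := by nlinarith [sq_nonneg (θ h - D)]
      calc D * r * θ h = D * θ h * r := by ring
        _ ≤ (D ^ 2 + 1 / 2) * r := by gcongr
        _ ≤ D ^ 2 * r + 5 := by linarith
  refine ⟨hbound.trans ?_, fun hle => hbound.trans ?_⟩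
  · rw [← Real.exp_add]
    refine Real.exp_le_exp.2 ?_
    have e13 : D ^ 2 / 2 - D ^ 2 * (r - 1) ^ 2 / 2 = D ^ 2 * r - D ^ 2 * r ^ 2 / 2 := by ring
    rw [e13]
    linarith
  · rw [← Real.exp_add]
    refine Real.exp_le_exp.2 ?_
    have : 0 ≤ D ^ 2 * r ^ 2 := by positivity
    linarith

/-- Once the clock has passed its range, a level has lost most of its stake. -/
lemma wealth_levelBet_le_quarter {τ : ℝ} (hτ : GoodLevel θ t₀ C L τ) (hθ : Monotone θ) (hC : 1 ≤ C)
    (ht₀ : 0 ≤ t₀) (hθ1 : 1 ≤ θ t₀) {ω : Ω} (hx : ∀ i, |S (i + 1) ω - S i ω| ≤ c (i + 1) ω)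
    (hSN : |S N ω| ≤ L) (hQN : quadVar S N ω ≤ L) {p n : ℕ} (hNp : N ≤ p) (hpn : p ≤ n)
    (hadm : ω ∈ admissible S c θ t₀ C N p) (hp : τ + Real.log 64 < logClock S t₀ p ω) :
    wealth S (levelBet S c θ t₀ C N τ) n ω ≤ 1 / 4 := by
  classical
  have hex : ∃ m, N ≤ m ∧ τ + Real.log 64 < logClock S t₀ m ω := ⟨p, hNp, hp⟩
  -- Betting stops at the first passage `m` of the clock above `τ + log 64`. There `r ≥ 8`, so the
  -- exponent is at most `8 + 28080 C - 24 D²`, and `D ≥ 432 C` makes it very negative.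
  set m := Nat.find hex with hm
  obtain ⟨hm1, hm2⟩ := Nat.find_spec hex
  have hmp : m ≤ p := Nat.find_min' hex ⟨hNp, hp⟩
  have hzero : wealth S (levelBet S c θ t₀ C N τ) n ω = wealth S (levelBet S c θ t₀ C N τ) m ω := by
    refine wealth_eq_of_eq_zero (hmp.trans hpn) fun i hi _ => levelBet_of_not fun hcon => ?_
    have := monotone_logClock (S := S) (t₀ := t₀) ω hi
    simp only at this
    linarith [hcon.2.2]
  have hb := (wealth_levelBet_le hτ hθ hC ht₀ hθ1 hx hSN hQN hm1 (fun i h1 h2 =>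
    ⟨admissible_antitone (by omega) hadm,
      not_lt.1 fun hcon => Nat.find_min hex h2 ⟨h1, hcon⟩⟩) (hadm.1 m hmp hm1)).1
  rw [hzero]
  refine hb.trans ?_
  rw [← Real.exp_add]
  have hr : 8 ≤ Real.exp ((logClock S t₀ m ω - τ) / 2) := by
    have h64 : Real.exp (Real.log 64 / 2) = 8 := by
      rw [show (64 : ℝ) = 8 ^ (2 : ℕ) by norm_num, Real.log_pow]
      push_cast
      rw [mul_div_cancel_left₀ _ two_ne_zero, Real.exp_log (by norm_num)]
    rw [← h64]
    exact Real.exp_le_exp.2 (by linarith)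
  set r := Real.exp ((logClock S t₀ m ω - τ) / 2) with hrdef
  have hD := hτ.large
  have h49 : 49 ≤ (r - 1) ^ 2 := by nlinarith
  have h2 : θ τ ^ 2 * 49 ≤ θ τ ^ 2 * (r - 1) ^ 2 := by gcongr
  have h3 : 432 * C * 432 ≤ θ τ ^ 2 := by nlinarith
  calc Real.exp (8 + 28080 * C + (θ τ ^ 2 / 2 - θ τ ^ 2 * (r - 1) ^ 2 / 2))
      ≤ Real.exp (-2) := Real.exp_le_exp.2 (by linarith)
    _ ≤ 1 / 4 := by
      rw [Real.exp_neg, one_div]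
      refine inv_anti₀ (by norm_num) ?_
      have : Real.exp 2 = Real.exp 1 ^ 2 := by rw [← Real.exp_nat_mul]; norm_num
      rw [this]
      nlinarith [Real.exp_one_gt_d9]

/-- Total wealth of the bettors at the grid levels in `K`, with Gaussian initial stakes. -/
noncomputable def mixture (S c : ℕ → Ω → ℝ) (θ : ℝ → ℝ) (t₀ C : ℝ) (N : ℕ) (K : Finset ℕ) (n : ℕ)
    (ω : Ω) : ℝ :=
  ∑ k ∈ K, Real.exp (-θ (grid θ t₀ k) ^ 2 / 2) *
    wealth S (levelBet S c θ t₀ C N (grid θ t₀ k)) n ω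

/-- Stake times wealth decays geometrically in the distance from the index matching the clock, apart
from frozen or negligible levels, which keep at most a multiple of their stake. `B` must precede
`L`, `N` and `K`, since the levels are chosen after the starting time and must be remote from it. -/
lemma exists_mixture_le (hθ : Monotone θ) (hC : 1 ≤ C) (ht₀ : 0 ≤ t₀) (hθ1 : 1 ≤ θ t₀) :
    ∃ B : ℝ, 2 ≤ B ∧ ∀ (L : ℝ) (N : ℕ) (K : Finset ℕ),
      (∀ k ∈ K, GoodLevel θ t₀ C L (grid θ t₀ k)) →
      ∑ k ∈ K, Real.exp (-θ (grid θ t₀ k) ^ 2 / 2) ≤ 2 →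
      ∀ ω, (∀ i, |S (i + 1) ω - S i ω| ≤ c (i + 1) ω) → |S N ω| ≤ L → quadVar S N ω ≤ L →
      ∀ n, mixture S c θ t₀ C N K n ω ≤ B := by
  classical
  obtain ⟨B₀, hB₀, hB⟩ := exists_sum_exp_neg_abs_le
  set E := Real.exp (8 + 28080 * C) with hE
  have hE0 : 0 < E := Real.exp_pos _
  have hextra : 0 ≤ 3 / 2 * E * (6 + B₀) := by positivity
  refine ⟨2 + 3 / 2 * E * (6 + B₀), by linarith, ?_⟩
  intro L N K hK hsum ω hx hSN hQN n
  set w : ℕ → ℝ := fun k => Real.exp (-θ (grid θ t₀ k) ^ 2 / 2) with hw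
  have hw0 : ∀ k, 0 < w k := fun k => Real.exp_pos _
  by_cases hex : ∃ p, p < n ∧ N ≤ p ∧ ω ∈ admissible S c θ t₀ C N p
  swap
  · have hone : ∀ k ∈ K, wealth S (levelBet S c θ t₀ C N (grid θ t₀ k)) n ω = 1 := by
      intro k _
      rw [wealth_eq_of_eq_zero (Nat.zero_le n) fun i _ hi => levelBet_of_not fun hcon =>
        hex ⟨i, hi, hcon.1, hcon.2.1⟩]
      simp [wealth]
    calc mixture S c θ t₀ C N K n ω = ∑ k ∈ K, w k :=
          Finset.sum_congr rfl fun k hk => by rw [hone k hk, mul_one]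
      _ ≤ _ := by linarith
  -- At the last admissible time `p` before `n` the path is still below the boundary; after it only
  -- one more bet is settled, which multiplies each wealth by at most `3 / 2`.
  obtain ⟨p, ⟨hpn, hNp, hadm⟩, hmax⟩ : ∃ p, (p < n ∧ N ≤ p ∧ ω ∈ admissible S c θ t₀ C N p) ∧
      ∀ q, p < q → ¬ (q < n ∧ N ≤ q ∧ ω ∈ admissible S c θ t₀ C N q) := by
    obtain ⟨p₀, hp₀⟩ := hex
    refine ⟨Nat.findGreatest (fun q => q < n ∧ N ≤ q ∧ ω ∈ admissible S c θ t₀ C N q) n,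
      Nat.findGreatest_spec (P := fun q => q < n ∧ N ≤ q ∧ ω ∈ admissible S c θ t₀ C N q)
        hp₀.1.le hp₀, fun q hq hcon => ?_⟩
    exact Nat.findGreatest_is_greatest hq hcon.1.le hcon
  set h := logClock S t₀ p ω with hh
  obtain ⟨k₀, hk₀, hk₀'⟩ := exists_grid_index (tendsto_grid hθ hθ1) (s := h) (le_logClock p ω)
  have hterm : ∀ k ∈ K, w k * wealth S (levelBet S c θ t₀ C N (grid θ t₀ k)) n ω ≤
      w k + 3 / 2 * E * (3 * w k + Real.exp (1 - |(k : ℝ) - k₀| / 64)) := by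
    intro k hk
    have hτ := hK k hk
    have habs := fun i => hτ.abs_levelBet_mul_le (N := N) hθ hC hθ1 hx i
    have hnn : ∀ i, 0 ≤ wealth S (levelBet S c θ t₀ C N (grid θ t₀ k)) i ω := fun i =>
      Finset.prod_nonneg fun j _ => by linarith [(abs_le.1 (habs j)).1]
    have hpos2 : 0 ≤ 3 / 2 * E * (3 * w k + Real.exp (1 - |(k : ℝ) - k₀| / 64)) := by
      have := hw0 k
      positivity
    rcases lt_or_ge (grid θ t₀ k + Real.log 64) h with hfro | hact
    · have h1 := wealth_levelBet_le_quarter hτ hθ hC ht₀ hθ1 hx hSN hQN hNp hpn.le hadm hfro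
      nlinarith [hw0 k]
    have h1 : wealth S (levelBet S c θ t₀ C N (grid θ t₀ k)) n ω =
        wealth S (levelBet S c θ t₀ C N (grid θ t₀ k)) (p + 1) ω :=
      wealth_eq_of_eq_zero hpn fun i hi hin => levelBet_of_not fun hcon =>
        hmax i hi ⟨hin, hcon.1, hcon.2.1⟩
    have h2 : wealth S (levelBet S c θ t₀ C N (grid θ t₀ k)) (p + 1) ω ≤
        3 / 2 * wealth S (levelBet S c θ t₀ C N (grid θ t₀ k)) p ω := by
      rw [wealth_succ, mul_comm]
      exact mul_le_mul_of_nonneg_right (by linarith [(abs_le.1 (habs p)).2]) (hnn p)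
    obtain ⟨h3, h4⟩ := wealth_levelBet_le hτ hθ hC ht₀ hθ1 hx hSN hQN hNp (fun i hi1 hi2 =>
      ⟨admissible_antitone hi2.le hadm, by
        have := monotone_logClock (S := S) (t₀ := t₀) ω hi2.le
        simp only at this
        linarith⟩) (hadm.1 p le_rfl hNp)
    have h5 : w k * wealth S (levelBet S c θ t₀ C N (grid θ t₀ k)) p ω ≤
        E * (3 * w k + Real.exp (1 - |(k : ℝ) - k₀| / 64)) := by
      rcases gaussian_exponent_le hθ hθ1 hk₀ hk₀' hτ.le_add_one hact with hg | ⟨hg1, hg2⟩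
      · calc w k * wealth S (levelBet S c θ t₀ C N (grid θ t₀ k)) p ω
            ≤ w k * _ := mul_le_mul_of_nonneg_left h3 (hw0 k).le
          _ = E * Real.exp (-(θ (grid θ t₀ k) ^ 2 *
                (Real.exp ((h - grid θ t₀ k) / 2) - 1) ^ 2 / 2)) := by
              rw [mul_left_comm, hw, ← Real.exp_add]
              congr 2
              ring
          _ ≤ E * Real.exp (1 - |(k : ℝ) - k₀| / 64) := by gcongr
          _ ≤ _ := by
              have := hw0 k
              gcongr
              linarith
      · calc w k * wealth S (levelBet S c θ t₀ C N (grid θ t₀ k)) p ω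
            ≤ w k * _ := mul_le_mul_of_nonneg_left (h4 hg1) (hw0 k).le
          _ ≤ w k * (E * 3) := by
              have := hw0 k
              gcongr
              exact (Real.exp_le_exp.2 hg2).trans (by linarith [Real.exp_one_lt_d9])
          _ = E * (3 * w k) := by ring
          _ ≤ _ := by
              have := Real.exp_pos (1 - |(k : ℝ) - k₀| / 64)
              gcongr
              linarith
    rw [h1]
    calc w k * wealth S (levelBet S c θ t₀ C N (grid θ t₀ k)) (p + 1) ω
        ≤ w k * (3 / 2 * wealth S (levelBet S c θ t₀ C N (grid θ t₀ k)) p ω) :=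
          mul_le_mul_of_nonneg_left h2 (hw0 k).le
      _ = 3 / 2 * (w k * wealth S (levelBet S c θ t₀ C N (grid θ t₀ k)) p ω) := by ring
      _ ≤ 3 / 2 * (E * (3 * w k + Real.exp (1 - |(k : ℝ) - k₀| / 64))) := by gcongr
      _ ≤ _ := by linarith [hw0 k]
  calc mixture S c θ t₀ C N K n ω
      ≤ ∑ k ∈ K, (w k + 3 / 2 * E * (3 * w k + Real.exp (1 - |(k : ℝ) - k₀| / 64))) :=
        Finset.sum_le_sum hterm
    _ = ∑ k ∈ K, w k + 3 / 2 * E *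
          (3 * ∑ k ∈ K, w k + ∑ k ∈ K, Real.exp (1 - |(k : ℝ) - k₀| / 64)) := by
        rw [Finset.sum_add_distrib, ← Finset.mul_sum, Finset.sum_add_distrib, ← Finset.mul_sum]
    _ ≤ 2 + 3 / 2 * E * (6 + B₀) := by
        have := hB K k₀
        have h2 : ∑ k ∈ K, w k ≤ 2 := hsum
        gcongr
        linarith

lemma eventually_mixture_le_half (hθ : Monotone θ) (hC : 1 ≤ C) (ht₀ : 0 ≤ t₀) (hθ1 : 1 ≤ θ t₀)
    {K : Finset ℕ} (hK : ∀ k ∈ K, GoodLevel θ t₀ C L (grid θ t₀ k))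
    (hsum : ∑ k ∈ K, Real.exp (-θ (grid θ t₀ k) ^ 2 / 2) ≤ 2) {ω : Ω}
    (hx : ∀ i, |S (i + 1) ω - S i ω| ≤ c (i + 1) ω) (hSN : |S N ω| ≤ L) (hQN : quadVar S N ω ≤ L)
    (hadm : ∀ i, ω ∈ admissible S c θ t₀ C N i)
    (hclock : Tendsto (fun n => logClock S t₀ n ω) atTop atTop) :
    ∀ᶠ n in atTop, mixture S c θ t₀ C N K n ω ≤ 1 / 2 := by
  have h1 : ∀ᶠ n in atTop, ∀ k ∈ K, grid θ t₀ k + Real.log 64 < logClock S t₀ n ω :=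
    (Finset.eventually_all K).2 fun k _ => hclock.eventually_gt_atTop _
  filter_upwards [h1, eventually_ge_atTop N] with n hn hNn
  calc mixture S c θ t₀ C N K n ω
      ≤ ∑ k ∈ K, Real.exp (-θ (grid θ t₀ k) ^ 2 / 2) * (1 / 4) := by
        refine Finset.sum_le_sum fun k hk => ?_
        have := wealth_levelBet_le_quarter (hK k hk) hθ hC ht₀ hθ1 hx hSN hQN hNn le_rfl (hadm n)
          (hn k hk)
        gcongr
    _ ≤ 1 / 2 := by
        rw [← Finset.sum_mul]
        linarith

end Lower

/-! ### The divergence half: conservation of the mean and Lévy's zero-one law -/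

section Levy

variable {Ω : Type*} {mΩ : MeasurableSpace Ω} {P : Measure Ω} [IsProbabilityMeasure P]
  {ℱ : Filtration ℕ mΩ}

/-- A terminal event whose conditional probabilities stay below a constant less than one is null. -/
lemma measure_eq_zero_of_forall_inter_le {G : Set Ω} (hG : MeasurableSet[⨆ n, ℱ n] G) {ρ : ℝ}
    (hρ0 : 0 ≤ ρ) (hρ : ρ < 1) (m : ℕ)
    (h : ∀ n, m ≤ n → ∀ F, MeasurableSet[ℱ n] F → P (G ∩ F) ≤ ENNReal.ofReal ρ * P F) :
    P G = 0 := by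
  have hle : (⨆ n, ℱ n) ≤ mΩ := iSup_le fun n => ℱ.le n
  have hGm : MeasurableSet G := hle G hG
  set g : Ω → ℝ := G.indicator fun _ => 1 with hg
  have hgint : Integrable g P := (integrable_const 1).indicator hGm
  have hlevy := tendsto_ae_condExp (μ := P) (ℱ := ℱ) g
  have hlim : P[g | ⨆ n, ℱ n] = g :=
    condExp_of_stronglyMeasurable hle (stronglyMeasurable_const.indicator hG) hgint
  rw [hlim] at hlevy
  -- Any threshold strictly between `ρ` and 1 works: the hypothesis makes these sets null, while on
  -- `G` the conditional probabilities tend to 1.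
  let F : ℕ → Set Ω := fun n => {ω | (1 + ρ) / 2 < (P[g | ℱ n]) ω}
  have hF : ∀ n, MeasurableSet[ℱ n] (F n) := fun n =>
    measurableSet_lt measurable_const stronglyMeasurable_condExp.measurable
  have hnull : ∀ n, m ≤ n → P (F n) = 0 := by
    intro n hn
    have hFm : MeasurableSet (F n) := ℱ.le n _ (hF n)
    have h1 : ∫ ω in F n, (P[g | ℱ n]) ω ∂P = P.real (G ∩ F n) := by
      rw [setIntegral_condExp (ℱ.le n) hgint (hF n), hg, integral_indicator_const _ hGm]
      simp [measureReal_restrict_apply hGm]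
    have h2 : (1 + ρ) / 2 * P.real (F n) ≤ ∫ ω in F n, (P[g | ℱ n]) ω ∂P := by
      have h3 : ∫ _ in F n, (1 + ρ) / 2 ∂P ≤ ∫ ω in F n, (P[g | ℱ n]) ω ∂P :=
        setIntegral_mono_on (integrable_const _).integrableOn integrable_condExp.integrableOn hFm
          fun ω hω => le_of_lt hω
      rw [setIntegral_const, smul_eq_mul, mul_comm] at h3
      exact h3
    have h3 : P.real (G ∩ F n) ≤ ρ * P.real (F n) := by
      have h4 := ENNReal.toReal_mono (ENNReal.mul_ne_top ENNReal.ofReal_ne_top (measure_ne_top _ _))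
        (h n hn (F n) (hF n))
      rwa [ENNReal.toReal_mul, ENNReal.toReal_ofReal hρ0] at h4
    have h4 : P.real (F n) = 0 := by
      have h5 : 0 ≤ P.real (F n) := measureReal_nonneg
      nlinarith
    exact (measureReal_eq_zero_iff).1 h4
  have hall : ∀ᵐ ω ∂P, ∀ n, m ≤ n → ω ∉ F n := by
    refine ae_all_iff.2 fun n => ?_
    by_cases hn : m ≤ n
    · have : ∀ᵐ ω ∂P, ω ∉ F n := measure_eq_zero_iff_ae_notMem.1 (hnull n hn)
      filter_upwards [this] with ω hω _ using hω
    · exact Eventually.of_forall fun ω h => absurd h hn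
  rw [measure_eq_zero_iff_ae_notMem]
  filter_upwards [hlevy, hall] with ω h1 h2 hω
  have h3 : g ω = 1 := by rw [hg, Set.indicator_of_mem hω]
  rw [h3] at h1
  obtain ⟨n, hn1, hn2⟩ := ((h1.eventually_const_lt (show (1 + ρ) / 2 < 1 by linarith)).and
    (eventually_ge_atTop m)).exists
  exact h2 n hn2 hn1

variable {S c : ℕ → Ω → ℝ} {θ : ℝ → ℝ} {t₀ C L : ℝ} {N : ℕ}

lemma setIntegral_mixture (hS : Martingale S ℱ P) (hc : ∀ i, Measurable[ℱ i] (c (i + 1)))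
    (hx : ∀ᵐ ω ∂P, ∀ i, |S (i + 1) ω - S i ω| ≤ c (i + 1) ω)
    (hθ : Monotone θ) (hC : 1 ≤ C) (hθ1 : 1 ≤ θ t₀) {K : Finset ℕ}
    (hK : ∀ k ∈ K, GoodLevel θ t₀ C L (grid θ t₀ k)) {F : Set Ω} (hF : MeasurableSet[ℱ N] F)
    {n : ℕ} (hn : N ≤ n) :
    Integrable (mixture S c θ t₀ C N K n) P ∧
      ∫ ω in F, mixture S c θ t₀ C N K n ω ∂P =
        (∑ k ∈ K, Real.exp (-θ (grid θ t₀ k) ^ 2 / 2)) * P.real F := by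
  have hm : ∀ k, ∀ i, Measurable[ℱ i] (levelBet S c θ t₀ C N (grid θ t₀ k) i) := fun k =>
    measurable_levelBet hS.stronglyAdapted hc hθ (grid θ t₀ k)
  have hb : ∀ k ∈ K, ∀ i, ∀ᵐ ω ∂P,
      |levelBet S c θ t₀ C N (grid θ t₀ k) i ω * (S (i + 1) ω - S i ω)| ≤ 1 / 2 := by
    intro k hk i
    filter_upwards [hx] with ω hω
    exact (hK k hk).abs_levelBet_mul_le hθ hC hθ1 hω i
  have hint : ∀ k ∈ K, Integrable (fun ω => Real.exp (-θ (grid θ t₀ k) ^ 2 / 2) *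
      wealth S (levelBet S c θ t₀ C N (grid θ t₀ k)) n ω) P := fun k hk =>
    (integrable_wealth hS (hm k) (hb k hk) n).const_mul _
  refine ⟨integrable_finsetSum _ hint, ?_⟩
  unfold mixture
  rw [integral_finsetSum _ fun k hk => (hint k hk).integrableOn, Finset.sum_mul]
  refine Finset.sum_congr rfl fun k hk => ?_
  rw [integral_const_mul, ← (martingale_wealth hS (hm k) (hb k hk)).setIntegral_eq hn hF]
  congr 1
  have hone : ∀ ω, wealth S (levelBet S c θ t₀ C N (grid θ t₀ k)) N ω = 1 := fun ω => by
    rw [wealth_eq_of_eq_zero (Nat.zero_le N) fun i _ hi => levelBet_of_not fun hcon => by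
      have := hcon.1
      omega]
    simp [wealth]
  simp only [hone]
  rw [setIntegral_const, smul_eq_mul, mul_one]

/-- The conditional probability of never crossing the boundary is bounded away from one. -/
lemma measure_inter_le_of_mixture_le (hS : Martingale S ℱ P)
    (hc : ∀ i, Measurable[ℱ i] (c (i + 1)))
    (hx : ∀ᵐ ω ∂P, ∀ i, |S (i + 1) ω - S i ω| ≤ c (i + 1) ω)
    (hθ : Monotone θ) (hC : 1 ≤ C) (ht₀ : 0 ≤ t₀) (hθ1 : 1 ≤ θ t₀) {B : ℝ} (hB2 : 2 ≤ B)
    {K : Finset ℕ} (hK : ∀ k ∈ K, GoodLevel θ t₀ C L (grid θ t₀ k))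
    (hsum1 : 1 ≤ ∑ k ∈ K, Real.exp (-θ (grid θ t₀ k) ^ 2 / 2))
    (hsum2 : ∑ k ∈ K, Real.exp (-θ (grid θ t₀ k) ^ 2 / 2) ≤ 2)
    (hB : ∀ ω, (∀ i, |S (i + 1) ω - S i ω| ≤ c (i + 1) ω) → |S N ω| ≤ L → quadVar S N ω ≤ L →
      ∀ n, mixture S c θ t₀ C N K n ω ≤ B)
    {F G : Set Ω} (hF : MeasurableSet[ℱ N] F) (hFL : ∀ ω ∈ F, |S N ω| ≤ L ∧ quadVar S N ω ≤ L)
    (hG : ∀ ω ∈ G, (∀ i, ω ∈ admissible S c θ t₀ C N i) ∧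
      Tendsto (fun n => logClock S t₀ n ω) atTop atTop) :
    P (G ∩ F) ≤ ENNReal.ofReal ((B - 1) / (B - 1 / 2)) * P F := by
  have hFm : MeasurableSet F := ℱ.le N F hF
  let A : ℕ → Set Ω := fun n => {ω | mixture S c θ t₀ C N K n ω ≤ 1 / 2}
  have hmeas : ∀ n, Measurable (mixture S c θ t₀ C N K n) := by
    intro n
    refine Finset.measurable_sum _ fun k _ => Measurable.const_mul ?_ _
    exact ((stronglyMeasurable_wealth hS
      (measurable_levelBet hS.stronglyAdapted hc hθ (grid θ t₀ k)) n).mono (ℱ.le n)).measurable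
  have hA : ∀ n, MeasurableSet (A n) := fun n => measurableSet_le (hmeas n) measurable_const
  -- The integral over `F` is at least `P F`, and the integrand is at most `1 / 2` on `A n` and at
  -- most `B` elsewhere.
  have hkey : ∀ n, N ≤ n → P (A n ∩ F) ≤ ENNReal.ofReal ((B - 1) / (B - 1 / 2)) * P F := by
    intro n hn
    obtain ⟨hint, hval⟩ := setIntegral_mixture hS hc hx hθ hC hθ1 hK hF hn
    have h1 : ∫ ω in F, mixture S c θ t₀ C N K n ω ∂P ≤
        ∫ ω in F, (B - (A n).indicator (fun _ => B - 1 / 2) ω) ∂P := by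
      refine setIntegral_mono_on_ae hint.integrableOn
        (((integrable_const B).sub ((integrable_const _).indicator (hA n))).integrableOn) hFm ?_
      filter_upwards [hx] with ω hω hωF
      by_cases hωA : ω ∈ A n
      · rw [Set.indicator_of_mem hωA]
        have : mixture S c θ t₀ C N K n ω ≤ 1 / 2 := hωA
        linarith
      · rw [Set.indicator_of_notMem hωA]
        linarith [hB ω hω (hFL ω hωF).1 (hFL ω hωF).2 n]
    have h2 : ∫ ω in F, (B - (A n).indicator (fun _ => B - 1 / 2) ω) ∂P =
        B * P.real F - (B - 1 / 2) * P.real (A n ∩ F) := by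
      rw [integral_sub (integrable_const B) ((integrable_const _).indicator (hA n)),
        setIntegral_const, integral_indicator_const _ (hA n), measureReal_restrict_apply (hA n)]
      simp only [smul_eq_mul]
      ring
    rw [hval, h2] at h1
    have h3 : 0 ≤ P.real F := measureReal_nonneg
    have h4 : P.real (A n ∩ F) ≤ (B - 1) / (B - 1 / 2) * P.real F := by
      rw [div_mul_eq_mul_div, le_div_iff₀ (by linarith)]
      nlinarith
    rw [← ofReal_measureReal (s := A n ∩ F), ← ofReal_measureReal (s := F),
      ← ENNReal.ofReal_mul (div_nonneg (by linarith) (by linarith))]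
    exact ENNReal.ofReal_le_ofReal h4
  let D : ℕ → Set Ω := fun T => ⋂ n ∈ Set.Ici T, A n ∩ F
  have hmono : Monotone D := fun a b hab => Set.biInter_subset_biInter_left
    (Set.Ici_subset_Ici.2 hab)
  have hsub : ∀ᵐ ω ∂P, ω ∈ G ∩ F → ω ∈ ⋃ T, D T := by
    filter_upwards [hx] with ω hω hmem
    obtain ⟨hadm, hclock⟩ := hG ω hmem.1
    obtain ⟨T, hT⟩ := eventually_atTop.1 (eventually_mixture_le_half hθ hC ht₀ hθ1 hK hsum2 hω
      (hFL ω hmem.2).1 (hFL ω hmem.2).2 hadm hclock)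
    exact Set.mem_iUnion.2 ⟨T, Set.mem_iInter₂.2 fun n hn => ⟨hT n hn, hmem.2⟩⟩
  calc P (G ∩ F) ≤ P (⋃ T, D T) := measure_mono_ae hsub
    _ = ⨆ T, P (D T) := hmono.measure_iUnion
    _ ≤ _ := iSup_le fun T => by
      refine (measure_mono ?_).trans (hkey (max T N) (le_max_right _ _))
      exact Set.biInter_subset_of_mem (le_max_left T N)

lemma eventually_goodLevel {ψ : ℝ → ℝ} (hpos : ∀ t ∈ Set.Ici (1 : ℝ), 0 < ψ t)
    (hmono : MonotoneOn ψ (Set.Ici (1 : ℝ))) (htop : Tendsto ψ atTop atTop) (ht₀ : 0 ≤ t₀)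
    (hθ1 : 1 ≤ logProfile ψ t₀) (hL : 0 ≤ L) :
    ∀ᶠ k in atTop, k ∈ regularIndices (logProfile ψ) t₀ →
      GoodLevel (logProfile ψ) t₀ C L (grid (logProfile ψ) t₀ k) := by
  have hθ := monotone_logProfile hpos hmono
  have hθtop : Tendsto (logProfile ψ) atTop atTop := by
    refine (htop.comp Real.tendsto_exp_atTop).congr' ?_
    filter_upwards [eventually_ge_atTop 0] with t ht
    rw [logProfile_of_nonneg ht, Function.comp]
  have hgrid := tendsto_grid hθ hθ1
  have hexp : Tendsto (fun t : ℝ => Real.exp (3 * t / 8)) atTop atTop :=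
    Real.tendsto_exp_atTop.comp ((tendsto_id.const_mul_atTop (by norm_num : (0 : ℝ) < 3 / 8)).congr
      fun t => by simp only [id]; ring)
  filter_upwards [hgrid.eventually (hθtop.eventually_ge_atTop (432 * C)),
    hgrid.eventually (hexp.eventually_ge_atTop (L + Real.exp t₀))] with k h1 h2 hk
  set τ := grid (logProfile ψ) t₀ k with hτ
  set D := logProfile ψ τ with hD
  have hD1 : 1 ≤ D := one_le_grid hθ hθ1 k
  refine ⟨ht₀.trans (le_grid hθ hθ1 k), hk.1, hk.2, h1, ?_⟩
  -- The value 0 of `logProfile` on the negative half-line enters here: regularity would fail at a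
  -- negative argument. Thus `D ≤ exp (τ / 8)`, leaving the factor `exp (3 τ / 8)` to beat `L + exp
  -- t₀`.
  have hlog : 0 ≤ τ - 8 * Real.log D := by
    by_contra hcon
    have h3 : D ≤ 3 * logProfile ψ (τ - 8 * Real.log D) := hk.2
    rw [logProfile, if_pos (not_le.1 hcon)] at h3
    linarith
  have hDle : D ≤ Real.exp (τ / 8) := by
    rw [← Real.log_le_iff_le_exp (by linarith)]
    linarith
  calc D * (L + Real.exp t₀) ≤ Real.exp (τ / 8) * Real.exp (3 * τ / 8) := by gcongr
    _ = Real.exp (τ / 2) := by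
      rw [← Real.exp_add]
      ring_nf

lemma ae_frequently_le_of_efkpIntegral_eq_top {ψ : ℝ → ℝ}
    (hS : Martingale S ℱ P)
    (hc : ∀ i, Measurable[ℱ i] (c (i + 1)))
    (hx : ∀ᵐ ω ∂P, ∀ i, |S (i + 1) ω - S i ω| ≤ c (i + 1) ω)
    (hpos : ∀ t ∈ Set.Ici (1 : ℝ), 0 < ψ t) (hmono : MonotoneOn ψ (Set.Ici (1 : ℝ)))
    (hI : efkpIntegral ψ = ⊤) (htop : Tendsto ψ atTop atTop) :
    ∀ᵐ ω ∂P, ω ∈ growthEvent S c ψ →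
      ∃ᶠ n in atTop, normalizer S n ω * ψ (quadVar S n ω) ≤ S n ω := by
  have hθ := monotone_logProfile hpos hmono
  obtain ⟨t₀, ht₀, hθ1⟩ : ∃ t₀ : ℝ, 0 ≤ t₀ ∧ 1 ≤ logProfile ψ t₀ := by
    obtain ⟨t, h1, h2⟩ := ((Real.tendsto_exp_atTop.eventually
      (htop.eventually_ge_atTop 1)).and (eventually_ge_atTop 0)).exists
    exact ⟨t, h2, by rwa [logProfile_of_nonneg h2]⟩
  -- Up to a null set, these countably many events contain the part of the growth event on which
  -- crossings cease; the unbounded clock is written out to make measurability evident.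
  let G : ℕ → ℕ → Set Ω := fun C m =>
    (⋂ i, admissible S c (logProfile ψ) t₀ C m i) ∩ ⋂ M : ℕ, ⋃ n, {ω | (M : ℝ) < logClock S t₀ n ω}
  have hadapt := hS.stronglyAdapted
  have hle : ∀ n, ℱ n ≤ ⨆ n, ℱ n := fun n => le_iSup (fun n => ℱ n) n
  have hGm : ∀ C m, MeasurableSet[⨆ n, ℱ n] (G C m) := by
    intro C m
    refine MeasurableSet.inter (MeasurableSet.iInter fun i => ?_)
      (MeasurableSet.iInter fun M => MeasurableSet.iUnion fun n => ?_)
    · exact hle i _ (measurableSet_admissible hadapt hc hθ i)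
    · exact hle n _ (measurableSet_lt measurable_const (measurable_logClock hadapt n))
  have hclock : ∀ C m, ∀ ω ∈ G C m, Tendsto (fun n => logClock S t₀ n ω) atTop atTop := by
    intro C m ω hω
    refine tendsto_atTop_atTop_of_monotone (monotone_logClock ω) fun T => ?_
    obtain ⟨M, hM⟩ := exists_nat_ge T
    obtain ⟨n, hn⟩ := Set.mem_iUnion.1 (Set.mem_iInter.1 hω.2 M)
    exact ⟨n, hM.trans (le_of_lt hn)⟩
  have hnull : ∀ C m, 1 ≤ C → P (G C m) = 0 := by
    intro C m hC
    have hC' : (1 : ℝ) ≤ C := by exact_mod_cast hC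
    obtain ⟨B, hB2, hB⟩ := exists_mixture_le (S := S) (c := c) hθ hC' ht₀ hθ1
    refine measure_eq_zero_of_forall_inter_le (hGm C m) (ρ := (B - 1) / (B - 1 / 2))
      (div_nonneg (by linarith) (by linarith)) ((div_lt_one (by linarith)).2 (by linarith)) m
      fun N hmN F hF => ?_
    -- The levels must be remote relative to the state at time `N`, so `F` is exhausted by sets
    -- where this state is bounded; the ratio obtained from `B` does not depend on `L`.
    let E : ℕ → Set Ω := fun L => F ∩ {ω | |S N ω| ≤ L ∧ quadVar S N ω ≤ L}
    have hEmono : Monotone fun L => G C m ∩ E L := by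
      intro a b hab ω hω
      have hab' : (a : ℝ) ≤ b := by exact_mod_cast hab
      exact ⟨hω.1, hω.2.1, hω.2.2.1.trans hab', hω.2.2.2.trans hab'⟩
    have hEcover : G C m ∩ F ⊆ ⋃ L, G C m ∩ E L := by
      intro ω hω
      obtain ⟨L, hL⟩ := exists_nat_ge (max |S N ω| (quadVar S N ω))
      exact Set.mem_iUnion.2 ⟨L, hω.1, hω.2, (le_max_left _ _).trans hL, (le_max_right _ _).trans hL⟩
    refine (measure_mono hEcover).trans ?_
    rw [hEmono.measure_iUnion]
    refine iSup_le fun L => ?_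
    obtain ⟨k₁, hk₁⟩ := eventually_atTop.1 (eventually_goodLevel (C := (C : ℝ)) (L := (L : ℝ))
      hpos hmono htop ht₀ hθ1 (Nat.cast_nonneg L))
    obtain ⟨K, hK, hsum1, hsum2⟩ := exists_finset_sum_mem_Icc
      (w := fun k => Real.exp (-logProfile ψ (grid (logProfile ψ) t₀ k) ^ 2 / 2))
      (fun k => (Real.exp_pos _).le)
      (fun k => Real.exp_le_one_iff.2 (by
        have := sq_nonneg (logProfile ψ (grid (logProfile ψ) t₀ k))
        linarith))
      (not_summable_regularIndices hpos hmono hI ht₀ hθ1) k₁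
    have hKgood : ∀ k ∈ K, GoodLevel (logProfile ψ) t₀ C L (grid (logProfile ψ) t₀ k) :=
      fun k hk => hk₁ k (hK k hk).2 (hK k hk).1
    have hset : MeasurableSet[ℱ N] {ω | |S N ω| ≤ L ∧ quadVar S N ω ≤ L} := by
      have h1 : Measurable[ℱ N] (S N) := (hadapt N).measurable
      exact (measurableSet_le (measurable_abs.comp h1) measurable_const).inter
        (measurableSet_le (measurable_quadVar hadapt N) measurable_const)
    refine (measure_inter_le_of_mixture_le hS hc hx hθ hC' ht₀ hθ1 hB2 hKgood hsum1 hsum2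
      (hB L N K hKgood hsum2) (hF.inter hset) (fun ω hω => hω.2) (fun ω hω => ⟨fun i => ?_,
        hclock C m ω hω⟩)).trans ?_
    · have := Set.mem_iInter.1 hω.1 i
      exact ⟨fun j hj hNj => this.1 j hj (hmN.trans hNj), this.2⟩
    · gcongr
      exact Set.inter_subset_left
  have hall : ∀ᵐ ω ∂P, ∀ C m : ℕ, 1 ≤ C → ω ∉ G C m := by
    refine ae_all_iff.2 fun C => ae_all_iff.2 fun m => ?_
    by_cases hC : 1 ≤ C
    · filter_upwards [measure_eq_zero_iff_ae_notMem.1 (hnull C m hC)] with ω hω _ using hω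
    · exact Eventually.of_forall fun ω h => absurd h hC
  filter_upwards [hx, hall] with ω hxω hω hmem
  by_contra hcon
  rw [not_frequently] at hcon
  have hQ := tendsto_quadVar_of_mem hmem
  have hclk := tendsto_logClock (t₀ := t₀) hQ
  obtain ⟨C, hC1, hC⟩ := exists_step_bound hpos hmono htop ht₀ hxω hmem
  obtain ⟨m, hm⟩ := eventually_atTop.1 (hcon.and (hQ.eventually_ge_atTop (Real.exp t₀)))
  refine hω C m hC1 ⟨Set.mem_iInter.2 fun i => ⟨fun j _ hmj => ?_, fun j _ => hC j⟩,
    Set.mem_iInter.2 fun M => Set.mem_iUnion.2 (hclk.eventually_gt_atTop (M : ℝ)).exists⟩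
  obtain ⟨h1, h2⟩ := hm j hmj
  rw [← normalizer_eq_exp h2, logProfile_logClock ht₀ h2]
  exact not_le.1 h1

end Levy

end SelfNormalized

theorem theorem1 {Ω : Type*} [mΩ : MeasurableSpace Ω] (P : Measure Ω) [IsProbabilityMeasure P]
    (ℱ : Filtration ℕ mΩ) (S c : ℕ → Ω → ℝ) (ψ : ℝ → ℝ)
    (hS : Martingale S ℱ P)
    (hS0 : ∀ᵐ ω ∂P, S 0 ω = 0)
    (hc_meas : ∀ n : ℕ, 1 ≤ n → Measurable[ℱ (n - 1)] (c n))
    (hc_bound : ∀ n : ℕ, 1 ≤ n → ∀ᵐ ω ∂P, |SelfNormalized.increment S n ω| ≤ c n ω)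
    (hψ_pos : ∀ t ∈ Set.Ici (1 : ℝ), 0 < ψ t)
    (hψ_mono : MonotoneOn ψ (Set.Ici (1 : ℝ)))
    (hψ_cont : ContinuousOn ψ (Set.Ici (1 : ℝ))) :
    (SelfNormalized.efkpIntegral ψ < ⊤ →
      ∀ᵐ ω ∂P, ω ∈ SelfNormalized.growthEvent S c ψ →
        ∀ᶠ n in atTop,
          S n ω < SelfNormalized.normalizer S n ω * ψ (SelfNormalized.quadVar S n ω)) ∧
    (SelfNormalized.efkpIntegral ψ = ⊤ → Tendsto ψ atTop atTop →
      ∀ᵐ ω ∂P, ω ∈ SelfNormalized.growthEvent S c ψ →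
        ∃ᶠ n in atTop,
          SelfNormalized.normalizer S n ω * ψ (SelfNormalized.quadVar S n ω) ≤ S n ω) := by
  have hc : ∀ i, Measurable[ℱ i] (c (i + 1)) := fun i => hc_meas (i + 1) (Nat.le_add_left 1 i)
  have hx : ∀ᵐ ω ∂P, ∀ i, |S (i + 1) ω - S i ω| ≤ c (i + 1) ω :=
    ae_all_iff.2 fun i => hc_bound (i + 1) (Nat.le_add_left 1 i)
  exact ⟨SelfNormalized.ae_eventually_lt_of_efkpIntegral_lt_top hS hS0 hc hx hψ_pos hψ_mono,
    SelfNormalized.ae_frequently_le_of_efkpIntegral_eq_top hS hc hx hψ_pos hψ_mono⟩
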